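/- Let $G$ be a connected Lie group and $K\subseteq G$ a closed connected Lie subgroup, with Lie algebras $\mathfrak k\subseteq\mathfrak g$. Let $\langle\cdot,\cdot\rangle$ be an $\mathrm{ad}$-invariant inner product on $\mathfrak g$ and $\mathfrak p$ the orthogonal complement of $\mathfrak k$ in $\mathfrak g$. Let $\{X_j\}$ and $\{Y_a\}$ be any orthonormal bases of $\mathfrak k$ and $\mathfrak p$. For $X\in\mathfrak k$ put $$\lambda^{\mathfrak p}(X)=-\tfrac12\sum_{a,b}\langle X,[Y_a,Y_b]\rangle\,Y_a\wedge Y_b\in\wedge^2(\mathfrak p),$$ and let $\mathcal A\colon C^\infty(\mathfrak k)\otimes\mathbb C\to\wedge(\mathfrak p^*)\otimes\mathbb C$ be the map that sends $\varphi$ to the image of $$\sum_{r\ge0}\frac1{r!}\Bigl(\sum_j\tfrac{i}{2\pi}\lambda^{\mathfrak p}(X_j)\,\partial_{j}\Bigr)^{r}\varphi(X)\Big|_{X=0}\in\wedge(\mathfrak p)\otimes\mathbb C$$ (a finite sum) under the isomorphism $\wedge(\mathfrak p)\cong\wedge(\mathfrak p^*)$ induced by the inner product; here $\partial_j$ is the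 partial derivative in the direction $X_j$. Let $\pi\colon G\to G/K$ be the projection, where $G/K$ carries the smooth structure for which $\pi$ is a submersion. Let $\theta$ be the canonical connection on the principal $K$-bundle $\pi$, that is, the orthogonal projection to $\mathfrak k$ of the left-invariant Maurer--Cartan form of $G$ (its horizontal space at the identity is $\mathfrak p$), and let $\Theta=d\theta+\frac12[\theta,\theta]$ be its curvature. Let $S(\mathfrak k^*)^{\mathfrak k}$ be the algebra of $\mathfrak k$-invariant polynomials on $\mathfrak k$. Then there is a unique homomorphism of real algebras $\mathrm{CW}\colon S(\mathfrak k^*)^{\mathfrak k}\to\Omega(G/K)\otimes\mathbb C$ with $\pi^*\mathrm{CW}(f)=f\bigl(\tfrac{i}{2\pi}\Theta\bigr)$ for all $f$ (the Chern--Weil homomorphism of $\pi$ with the connection $\theta$), and, identifying $\mathfrak p$ with the tangent space of $G/K$ at the identity coset $\bar e$ by the differential of $\pi$ at the identity, $$\mathcal A(f)=\mathrm{CW}(f)\big|_{\bar e}\in\wedge(\mathfrak p^*)\otimes\mathbb C\qquad\text{for every } f\in S(\mathfrak k^*)^{\mathfrak k}.$$ -/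

import Mathlib

open scoped Manifold ContDiff TensorProduct

noncomputable section

namespace HomChernWeil

/-! ### Complexified exterior algebras of dual spaces -/

/-- The complexified exterior algebra `Λ(V*) ⊗ ℂ` of the dual of a real vector space `V`. -/
abbrev CForms (V : Type*) [AddCommGroup V] [Module ℝ V] : Type _ :=
  ℂ ⊗[ℝ] ExteriorAlgebra ℝ (Module.Dual ℝ V)

/-- The pullback `L^* : Λ(W*) ⊗ ℂ → Λ(V*) ⊗ ℂ` along a linear map `L : V → W`. -/
def CForms.pull {V W : Type*} [AddCommGroup V] [Module ℝ V] [AddCommGroup W] [Module ℝ W]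
    (L : V →ₗ[ℝ] W) : CForms W →ₐ[ℂ] CForms V :=
  Algebra.TensorProduct.map (AlgHom.id ℂ ℂ) (ExteriorAlgebra.map L.dualMap)

/-- The element `½ ∑ β(e_a, e_b) e^a ∧ e^b` of `Λ²(V*)` that corresponds to an alternating
bilinear form `β` on `V`; here `e` is a basis of `V` and `e^a` are the dual covectors. (Thus
`ξ ∧ η` corresponds to the form `(v, w) ↦ ξ v * η w - ξ w * η v`.) -/
def ofTwoForm {V : Type*} [AddCommGroup V] [Module ℝ V] [FiniteDimensional ℝ V]
    (β : V → V → ℝ) : ExteriorAlgebra ℝ (Module.Dual ℝ V) :=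
  (1 / 2 : ℝ) • ∑ a, ∑ b,
    β (Module.finBasis ℝ V a) (Module.finBasis ℝ V b) •
      (ExteriorAlgebra.ι ℝ ((Module.finBasis ℝ V).coord a) *
        ExteriorAlgebra.ι ℝ ((Module.finBasis ℝ V).coord b))

theorem ι_mul_ι_commute_ι {V : Type*} [AddCommGroup V] [Module ℝ V] (a b c : V) :
    Commute (ExteriorAlgebra.ι ℝ a * ExteriorAlgebra.ι ℝ b) (ExteriorAlgebra.ι ℝ c) := by
  have h : ∀ x y : V, ExteriorAlgebra.ι ℝ x * ExteriorAlgebra.ι ℝ y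
      = - (ExteriorAlgebra.ι ℝ y * ExteriorAlgebra.ι ℝ x) := fun x y =>
    eq_neg_of_add_eq_zero_left (ExteriorAlgebra.ι_add_mul_swap x y)
  show _ * _ = _ * _
  rw [mul_assoc, h b c, mul_neg, ← mul_assoc, h a c, neg_mul, neg_neg, mul_assoc]

theorem ofTwoForm_commute {V : Type*} [AddCommGroup V] [Module ℝ V] [FiniteDimensional ℝ V]
    (β γ : V → V → ℝ) : Commute (ofTwoForm β) (ofTwoForm γ) := by
  unfold ofTwoForm
  refine ((Commute.sum_left _ _ _ fun a _ => Commute.sum_left _ _ _ fun b _ =>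
    Commute.sum_right _ _ _ fun c _ =>
      Commute.sum_right _ _ _ fun d _ => ?_).smul_left _).smul_right _
  exact (((ι_mul_ι_commute_ι _ _ _).mul_right (ι_mul_ι_commute_ι _ _ _)).smul_left _).smul_right _

theorem ofTwoForm_add {V : Type*} [AddCommGroup V] [Module ℝ V] [FiniteDimensional ℝ V]
    (β γ : V → V → ℝ) :
    ofTwoForm (fun v w => β v w + γ v w) = ofTwoForm β + ofTwoForm γ := by
  simp only [ofTwoForm, add_smul, Finset.sum_add_distrib, smul_add]

theorem ofTwoForm_smul {V : Type*} [AddCommGroup V] [Module ℝ V] [FiniteDimensional ℝ V]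
    (c : ℝ) (β : V → V → ℝ) :
    ofTwoForm (fun v w => c * β v w) = c • ofTwoForm β := by
  simp only [ofTwoForm, mul_smul, ← Finset.smul_sum]
  rw [smul_comm]

/-! ### Polynomials and smooth functions on a vector space -/

/-- Substitution `f ↦ f(c)`: the algebra homomorphism `S(U) → A` that extends a linear map
`c : U → A` whose values commute with each other. -/
def polySubst {U A : Type*} [AddCommGroup U] [Module ℝ U] [Ring A] [Algebra ℝ A] (c : U →ₗ[ℝ] A)
    (hc : ∀ x y, Commute (c x) (c y)) : SymmetricAlgebra ℝ U →ₐ[ℝ] A :=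
  RingCon.liftₐ (TensorAlgebra.symRingCon ℝ U) (TensorAlgebra.lift ℝ c) (by
    refine RingCon.ringConGen_le.2 ?_
    rintro _ _ ⟨x, y⟩
    rw [RingCon.ker_apply]
    simpa using (hc x y).eq)

theorem polySubst_ι {U A : Type*} [AddCommGroup U] [Module ℝ U] [Ring A] [Algebra ℝ A]
    (c : U →ₗ[ℝ] A) (hc : ∀ x y, Commute (c x) (c y)) (x : U) :
    polySubst c hc (SymmetricAlgebra.ι ℝ U x) = c x :=
  (RingCon.liftₐ_mk _ _ _ _).trans (TensorAlgebra.lift_ι_apply c x)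

section Poly

variable {V : Type*} [AddCommGroup V] [Module ℝ V]

/-- The polynomial function on `V` given by an element of `S(V*)`. -/
def polyFun (f : SymmetricAlgebra ℝ (Module.Dual ℝ V)) (x : V) : ℝ :=
  SymmetricAlgebra.lift (Module.Dual.eval ℝ V x) f

/-- `C^∞(V) ⊗ ℂ`, the smooth complex-valued functions on a finite-dimensional real vector space
`V` (smooth in all linear parametrizations of `V`). -/
def SmoothFun (V : Type*) [AddCommGroup V] [Module ℝ V] : Type _ :=
  {φ : V → ℂ // ∀ (n : ℕ) (L : (Fin n → ℝ) →ₗ[ℝ] V), ContDiff ℝ ∞ (φ ∘ L)}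

theorem polyFun_contDiff {W : Type*} [NormedAddCommGroup W] [NormedSpace ℝ W]
    [FiniteDimensional ℝ W] (f : SymmetricAlgebra ℝ (Module.Dual ℝ V)) (v : V) (L : W →ₗ[ℝ] V) :
    ContDiff ℝ ∞ fun x => polyFun f (v + L x) := by
  induction f using SymmetricAlgebra.induction with
  | algebraMap r => simpa [polyFun] using contDiff_const
  | ι ξ =>
    have h : ContDiff ℝ ∞ fun x => ξ v + LinearMap.toContinuousLinearMap (ξ ∘ₗ L) x :=
      contDiff_const.add (ContinuousLinearMap.contDiff _)
    simpa [polyFun] using h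
  | mul a b ha hb => simpa [polyFun] using ha.mul hb
  | add a b ha hb => simpa [polyFun] using ha.add hb

/-- The inclusion of the polynomials `S(V*)` into `C^∞(V) ⊗ ℂ`. -/
def polyInc (f : SymmetricAlgebra ℝ (Module.Dual ℝ V)) : SmoothFun V :=
  ⟨fun x => (polyFun f x : ℂ), fun n L => by
    have h := polyFun_contDiff f 0 L
    simp only [zero_add] at h
    exact Complex.ofRealCLM.contDiff.comp h⟩

theorem polyFun_lineDifferentiableAt (f : SymmetricAlgebra ℝ (Module.Dual ℝ V)) (x v : V) :
    LineDifferentiableAt ℝ (polyFun f) x v := by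
  have h := polyFun_contDiff f x (LinearMap.toSpanSingleton ℝ V v)
  exact h.contDiffAt.differentiableAt (by simp)

/-- The algebra `S(V*)^V` of invariant polynomials on a Lie algebra `V`: those whose derivative at
every `y` in every direction `[x, y]` vanishes. -/
def invPoly (V : Type*) [AddCommGroup V] [Module ℝ V] [Bracket V V] :
    Subalgebra ℝ (SymmetricAlgebra ℝ (Module.Dual ℝ V)) where
  carrier := {f | ∀ x y : V, lineDeriv ℝ (polyFun f) y ⁅x, y⁆ = 0}
  algebraMap_mem' r x y := by
    have : polyFun (V := V) (algebraMap ℝ _ r) = fun _ => r := by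
      funext z; simp [polyFun]
    rw [this]; simp [lineDeriv]
  add_mem' {f g} hf hg x y := by
    have : polyFun (f + g) = fun z => polyFun f z + polyFun g z := by
      funext z; simp [polyFun]
    have h1 := (polyFun_lineDifferentiableAt f y ⁅x, y⁆).hasLineDerivAt
    have h2 := (polyFun_lineDifferentiableAt g y ⁅x, y⁆).hasLineDerivAt
    rw [hf x y] at h1
    rw [hg x y] at h2
    rw [this]
    have h3 : HasLineDerivAt ℝ (fun z => polyFun f z + polyFun g z) (0 + 0) y ⁅x, y⁆ :=
      HasDerivAt.add h1 h2
    simpa using h3.lineDeriv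
  mul_mem' {f g} hf hg x y := by
    have : polyFun (f * g) = fun z => polyFun f z * polyFun g z := by
      funext z; simp [polyFun]
    have h1 := (polyFun_lineDifferentiableAt f y ⁅x, y⁆).hasLineDerivAt
    have h2 := (polyFun_lineDifferentiableAt g y ⁅x, y⁆).hasLineDerivAt
    rw [hf x y] at h1
    rw [hg x y] at h2
    rw [this]
    have h3 := (HasDerivAt.mul h1 h2).deriv
    simp only [lineDeriv]
    exact h3.trans (by simp)

end Poly

/-! ### Differential forms on manifolds -/

section Forms

variable {E : Type*} [NormedAddCommGroup E] [NormedSpace ℝ E]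
  {M : Type*} [TopologicalSpace M] [ChartedSpace E M]

instance instFiniteDimensionalTangentSpace [FiniteDimensional ℝ E] (x : M) :
    FiniteDimensional ℝ (TangentSpace 𝓘(ℝ, E) x) :=
  inferInstanceAs (FiniteDimensional ℝ E)

/-- The differential at `z` of the inverse of the preferred chart at `x`. -/
def dChartSymm (x : M) (z : E) : E →L[ℝ] TangentSpace 𝓘(ℝ, E) ((extChartAt 𝓘(ℝ, E) x).symm z) :=
  mfderiv 𝓘(ℝ, E) 𝓘(ℝ, E) (extChartAt 𝓘(ℝ, E) x).symm z

/-- The local representation, in the preferred chart at `x`, of a differential form. -/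
def localForm (σ : Π y : M, CForms (TangentSpace 𝓘(ℝ, E) y)) (x : M) (z : E) : CForms E :=
  CForms.pull (dChartSymm x z).toLinearMap (σ ((extChartAt 𝓘(ℝ, E) x).symm z))

variable (E M) in
/-- The algebra `Ω(M) ⊗ ℂ` of smooth complex-valued differential forms: in each chart such a form
is a combination of constant forms with smooth coefficients. The product is the wedge product. -/
def SmoothForms : Subalgebra ℂ (Π x : M, CForms (TangentSpace 𝓘(ℝ, E) x)) where
  carrier := {σ | ∀ x : M, ∃ (κ : Type) (_ : Fintype κ) (c : κ → E → ℝ) (a : κ → CForms E),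
    (∀ i, ContDiffOn ℝ ∞ (c i) (extChartAt 𝓘(ℝ, E) x).target) ∧
      ∀ z ∈ (extChartAt 𝓘(ℝ, E) x).target, localForm σ x z = ∑ i, c i z • a i}
  algebraMap_mem' r x := by
    refine ⟨Unit, inferInstance, fun _ _ => 1, fun _ => algebraMap ℂ _ r,
      fun _ => contDiffOn_const, fun z _ => ?_⟩
    simp only [localForm, Pi.algebraMap_apply]
    rw [AlgHom.commutes]
    simp
  add_mem' {σ η} hσ hη x := by
    obtain ⟨κ, _, c, a, hc, h⟩ := hσ x
    obtain ⟨κ', _, c', a', hc', h'⟩ := hη x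
    refine ⟨κ ⊕ κ', inferInstance, Sum.elim c c', Sum.elim a a', ?_, fun z hz => ?_⟩
    · rintro (i | i)
      · exact hc i
      · exact hc' i
    · have : localForm (σ + η) x z = localForm σ x z + localForm η x z := map_add _ _ _
      rw [this, h z hz, h' z hz]
      simp
  mul_mem' {σ η} hσ hη x := by
    obtain ⟨κ, _, c, a, hc, h⟩ := hσ x
    obtain ⟨κ', _, c', a', hc', h'⟩ := hη x
    refine ⟨κ × κ', inferInstance, fun i z => c i.1 z * c' i.2 z, fun i => a i.1 * a' i.2,
      fun i => (hc i.1).mul (hc' i.2), fun z hz => ?_⟩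
    have : localForm (σ * η) x z = localForm σ x z * localForm η x z := map_mul _ _ _
    rw [this, h z hz, h' z hz, Finset.sum_mul_sum, Fintype.sum_prod_type]
    simp only [smul_mul_smul_comm]

/-- The exterior derivative of a vector-valued 1-form, computed in the preferred chart at the
point: `dα(v, w) = ∂_v α(w) - ∂_w α(v)` for vectors `v`, `w` extended constantly in the chart. -/
def extDerivOneForm {W : Type*} [AddCommGroup W] [Module ℝ W] [TopologicalSpace W]
    (α : Π x : M, TangentSpace 𝓘(ℝ, E) x → W) (x : M) (v w : TangentSpace 𝓘(ℝ, E) x) : W :=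
  let v' : E := mfderiv 𝓘(ℝ, E) 𝓘(ℝ, E) (extChartAt 𝓘(ℝ, E) x) x v
  let w' : E := mfderiv 𝓘(ℝ, E) 𝓘(ℝ, E) (extChartAt 𝓘(ℝ, E) x) x w
  let αloc : E → E → W := fun u z => α ((extChartAt 𝓘(ℝ, E) x).symm z) (dChartSymm x z u)
  fderiv ℝ (αloc w') (extChartAt 𝓘(ℝ, E) x x) v' -
    fderiv ℝ (αloc v') (extChartAt 𝓘(ℝ, E) x x) w'

variable {E' : Type*} [NormedAddCommGroup E'] [NormedSpace ℝ E']
  {N : Type*} [TopologicalSpace N] [ChartedSpace E' N]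

/-- The pullback of a differential form along a map, at the point `x`. -/
def pullbackForm (q : M → N) (σ : Π y : N, CForms (TangentSpace 𝓘(ℝ, E') y)) (x : M) :
    CForms (TangentSpace 𝓘(ℝ, E) x) :=
  CForms.pull (mfderiv 𝓘(ℝ, E) 𝓘(ℝ, E') q x).toLinearMap (σ (q x))

end Forms

/-- An inner product on a real Lie algebra that is invariant under the adjoint representation. -/
structure InvariantInner (L : Type*) [AddCommGroup L] [Module ℝ L] [Bracket L L] where
  /-- the underlying bilinear form -/
  form : LinearMap.BilinForm ℝ L
  symm : ∀ x y, form x y = form y x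
  pos : ∀ x, x ≠ 0 → 0 < form x x
  invariant : ∀ x y z : L, form ⁅x, y⁆ z + form y ⁅x, z⁆ = 0

/-! ### The homogeneous space `G → G/K` -/

section Homogeneous

variable {E : Type*} [NormedAddCommGroup E] [NormedSpace ℝ E]
  {F : Type*} [NormedAddCommGroup F] [NormedSpace ℝ F]
  {G : Type*} [TopologicalSpace G] [ChartedSpace E G] [Group G]
  {K : Subgroup G} [ChartedSpace F K]

/-- The inclusion `𝔨 → 𝔤` of Lie algebras, i.e. the differential of `K → G` at the identity. -/
def lieInc : GroupLieAlgebra 𝓘(ℝ, F) K →ₗ[ℝ] GroupLieAlgebra 𝓘(ℝ, E) G :=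
  (mfderiv 𝓘(ℝ, F) 𝓘(ℝ, E) (Subtype.val : K → G) 1).toLinearMap

variable (F K) in
/-- The orthogonal complement `𝔭` of `𝔨` in `𝔤`. -/
def pSpace (B : InvariantInner (GroupLieAlgebra 𝓘(ℝ, E) G)) :
    Submodule ℝ (GroupLieAlgebra 𝓘(ℝ, E) G) where
  carrier := {y | ∀ x : GroupLieAlgebra 𝓘(ℝ, F) K, B.form (lieInc x) y = 0}
  zero_mem' x := map_zero _
  add_mem' {y z} hy hz x := by rw [map_add, hy x, hz x, add_zero]
  smul_mem' c y hy x := by rw [map_smul, hy x, smul_zero]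

/-- The Maurer-Cartan form of `G`: left translation of tangent vectors to the identity. -/
def maurerCartan (g : G) (v : TangentSpace 𝓘(ℝ, E) g) : GroupLieAlgebra 𝓘(ℝ, E) G :=
  mfderiv 𝓘(ℝ, E) 𝓘(ℝ, E) (fun h : G => g⁻¹ * h) g v

variable (B : InvariantInner (GroupLieAlgebra 𝓘(ℝ, E) G))
  {m : Type*} [Fintype m] (X : Module.Basis m ℝ (GroupLieAlgebra 𝓘(ℝ, F) K))
  {n : Type*} [Fintype n] (Y : Module.Basis n ℝ (pSpace F K B))

/-- `X` is an orthonormal basis of `𝔨`. -/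
def OrthonormalK [DecidableEq m] : Prop :=
  ∀ i j, B.form (lieInc (X i)) (lieInc (X j)) = if i = j then 1 else 0

/-- `Y` is an orthonormal basis of `𝔭`. -/
def OrthonormalP [DecidableEq n] : Prop :=
  ∀ i j, B.form (Y i) (Y j) = if i = j then 1 else 0

/-- The canonical connection form on the principal bundle `G → G/K`: the orthogonal projection to
`𝔨` of the Maurer-Cartan form of `G`, written in an orthonormal basis `X` of `𝔨`; at the identity
it is `∑ X_i ⊗ X_i^*`, and its horizontal space there is `𝔭`. -/
def connection (g : G) (v : TangentSpace 𝓘(ℝ, E) g) : GroupLieAlgebra 𝓘(ℝ, F) K :=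
  ∑ i, B.form (lieInc (X i)) (maurerCartan g v) • X i

/-- The curvature `Θ = dθ + ½[θ, θ]` of the connection `θ`, where
`½[θ, θ](v, w) = [θ(v), θ(w)]`. -/
def curvature (g : G) (v w : TangentSpace 𝓘(ℝ, E) g) : GroupLieAlgebra 𝓘(ℝ, F) K :=
  extDerivOneForm (connection B X) g v w + ⁅connection B X g v, connection B X g w⁆

variable [FiniteDimensional ℝ E]

/-- The linear map `ξ ↦ ξ(iΘ/2π)` from `𝔨*` to the exterior algebra of the cotangent space of `G`
at `g`. -/
def curvatureCov (g : G) :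
    Module.Dual ℝ (GroupLieAlgebra 𝓘(ℝ, F) K) →ₗ[ℝ] CForms (TangentSpace 𝓘(ℝ, E) g) where
  toFun ξ := (Complex.I / (2 * Real.pi)) ⊗ₜ[ℝ] ofTwoForm fun v w => ξ (curvature B X g v w)
  map_add' ξ η := by
    rw [← TensorProduct.tmul_add, ← ofTwoForm_add]; rfl
  map_smul' c ξ := by
    rw [RingHom.id_apply, ← TensorProduct.tmul_smul, ← ofTwoForm_smul]; rfl

/-- `f(iΘ/2π)` at the point `g` of `G`, for a polynomial `f` on `𝔨`. -/
def polyCurvature (g : G) :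
    SymmetricAlgebra ℝ (Module.Dual ℝ (GroupLieAlgebra 𝓘(ℝ, F) K)) →ₐ[ℝ]
      CForms (TangentSpace 𝓘(ℝ, E) g) :=
  polySubst (curvatureCov B X g) fun ξ η => by
    show _ ⊗ₜ[ℝ] _ * _ ⊗ₜ[ℝ] _ = _ ⊗ₜ[ℝ] _ * _ ⊗ₜ[ℝ] _
    rw [Algebra.TensorProduct.tmul_mul_tmul, Algebra.TensorProduct.tmul_mul_tmul,
      (ofTwoForm_commute _ _).eq]

section Quotient

variable {E' : Type*} [NormedAddCommGroup E'] [NormedSpace ℝ E'] [ChartedSpace E' (G ⧸ K)]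

/-- `CW` is the Chern-Weil homomorphism `S(𝔨*)^𝔨 → Ω(G/K) ⊗ ℂ` of the principal bundle
`π : G → G/K` with its canonical connection: `π^* CW(f) = f(iΘ/2π)` for every `f`. -/
def IsChernWeil
    (CW : invPoly (GroupLieAlgebra 𝓘(ℝ, F) K) →ₐ[ℝ] SmoothForms E' (G ⧸ K)) : Prop :=
  ∀ (f : invPoly (GroupLieAlgebra 𝓘(ℝ, F) K)) (g : G),
    pullbackForm (E := E) (E' := E') (QuotientGroup.mk : G → G ⧸ K) (CW f).1 g =
      polyCurvature B X g f.1

/-- Restriction of a differential form on `G/K` to the identity coset, as an element of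
`Λ(𝔭*) ⊗ ℂ`; here `𝔭` is identified with the tangent space of `G/K` at the identity coset by the
differential of `π : G → G/K`. -/
def resIdentity (σ : SmoothForms E' (G ⧸ K)) : CForms (pSpace F K B) :=
  CForms.pull ((mfderiv 𝓘(ℝ, E) 𝓘(ℝ, E') (QuotientGroup.mk : G → G ⧸ K) 1).toLinearMap ∘ₗ
    (pSpace F K B).subtype) (σ.1 (QuotientGroup.mk 1))

end Quotient

/-! ### The map `𝒜` -/

/-- `λ(x) = -½ ∑ ⟨x, [Y_i, Y_j]⟩ Y_i Y_j ∈ Λ²(𝔭)` for `x ∈ 𝔨`. -/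
def lam (x : GroupLieAlgebra 𝓘(ℝ, F) K) : ExteriorAlgebra ℝ (pSpace F K B) :=
  (-1 / 2 : ℝ) • ∑ i, ∑ j,
    B.form (lieInc x) ⁅(Y i : GroupLieAlgebra 𝓘(ℝ, E) G), (Y j : GroupLieAlgebra 𝓘(ℝ, E) G)⁆ •
      (ExteriorAlgebra.ι ℝ (Y i) * ExteriorAlgebra.ι ℝ (Y j))

/-- The rescaled element `iλ(x)/2π` of `Λ(𝔭) ⊗ ℂ`. -/
def lamBar (x : GroupLieAlgebra 𝓘(ℝ, F) K) : ℂ ⊗[ℝ] ExteriorAlgebra ℝ (pSpace F K B) :=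
  (Complex.I / (2 * Real.pi)) ⊗ₜ[ℝ] lam B Y x

/-- The iterated partial derivative `∂_{j_1} ⋯ ∂_{j_r} φ` with respect to the linear coordinates
given by the basis `X`. -/
def iterPartial : List m → (GroupLieAlgebra 𝓘(ℝ, F) K → ℂ) → GroupLieAlgebra 𝓘(ℝ, F) K → ℂ
  | [], φ => φ
  | j :: l, φ => fun x => lineDeriv ℝ (iterPartial l φ) x (X j)

/-- `φ(iλ/2π) = ∑_r (1/r!) (∑_j (iλ(X_j)/2π) ∂_j)^r φ |_0` in `Λ(𝔭) ⊗ ℂ`, with the powers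
expanded. Only finitely many `r` contribute. -/
def taylorSubst (φ : SmoothFun (GroupLieAlgebra 𝓘(ℝ, F) K)) :
    ℂ ⊗[ℝ] ExteriorAlgebra ℝ (pSpace F K B) :=
  ∑ᶠ r : ℕ, (1 / (r.factorial : ℂ)) • ∑ j : Fin r → m,
    iterPartial X (List.ofFn j) φ.1 0 • (List.ofFn fun l => lamBar B Y (X (j l))).prod

/-- The identification `𝔭 → 𝔭*` by the inner product. -/
def flat : pSpace F K B →ₗ[ℝ] Module.Dual ℝ (pSpace F K B) :=
  B.form.domRestrict₁₂ (pSpace F K B) (pSpace F K B)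

/-- The map `𝒜 : C^∞(𝔨) ⊗ ℂ → Λ(𝔭*) ⊗ ℂ`. -/
def mapA (φ : SmoothFun (GroupLieAlgebra 𝓘(ℝ, F) K)) : CForms (pSpace F K B) :=
  Algebra.TensorProduct.map (AlgHom.id ℂ ℂ) (ExteriorAlgebra.map (flat B)) (taylorSubst B X Y φ)

end Homogeneous

end HomChernWeil

end

open HomChernWeil

/-!
The theorem reduces to a computation in the Lie algebra `𝔤`, because the forms involved on
`G` are left invariant.

Write `ω` for the Maurer-Cartan form, so that the canonical connection is `θ = pr_𝔨 ∘ ω`. The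
Maurer-Cartan equation (`extDerivOneForm_maurerCartan`) and the invariance of the inner product,
which gives `[𝔨, 𝔭] ⊆ 𝔭`, yield `Θ(v, w) = -pr_𝔨 [pr_𝔭 ω(v), pr_𝔭 ω(w)]` (`curvature_eq`). Hence
`f(iΘ/2π)` at `g` is the pullback along `ω_g` of its value `A_f` at the identity
(`polyCurvature_eq_pull`).

*Existence of the Chern-Weil homomorphism.* The form `A_f` only sees `𝔭`-components. It is also
invariant under `Ad(k)` for `k ∈ K` when `f` is invariant under `𝔨`: the derivative of `Ad` at the
identity is the bracket (`hasMFDerivAt_AdOrbit`), so infinitesimal invariance integrates over a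
connected group (`apply_Ad_eq_of_fderiv_lie_eq_zero`); this is applied to `f` on `K` and to the
inner product on `G`. The kernel of `dπ` at `g` is contained in `ω_g⁻¹(𝔨)`
(`exists_lieInc_eq_maurerCartan`): by the submersion theorem a vertical vector is the velocity of a
curve in a coset of `K`, and `K → G` is an immersion that carries the subspace topology. Together
these facts say that the pullback of `f(iΘ/2π)` along a linear map into a tangent space of `G`
depends only on the composition with `dπ` (`pull_comp_mcLin_eq`). So arbitrary lifts of tangent
vectors descend `f(iΘ/2π)` to `G/K`, and lifting along a local section of `π` shows that the result
is smooth (`descended_mem_smoothForms`). Uniqueness holds because `dπ` is surjective.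

*The formula.* The restriction of `CW(f)` to the identity coset is the restriction of `A_f` to `𝔭`.
On the other side, `∑_r (1/r!) (∑_j N_j ∂_j)^r f |_0` for commuting `N_j` is the substitution of
`N_j` for the coordinates in the polynomial `f` (`finsum_taylorTerm`). Both sides are therefore
algebra homomorphisms in `f`, and on a covector `ξ` they agree since `∑_j ξ(X_j) λ(X_j) = -½
∑_{a,b} ξ(pr_𝔨 [Y_a, Y_b]) Y_a ∧ Y_b` (`map_flat_lamCov`).
-/

noncomputable section

namespace HomChernWeil

/-! ### Polynomials -/

section Polynomials

theorem symmetricAlgebra_algHom_ext {U A : Type*} [AddCommGroup U] [Module ℝ U] [Ring A]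
    [Algebra ℝ A] {f g : SymmetricAlgebra ℝ U →ₐ[ℝ] A}
    (h : ∀ x, f (SymmetricAlgebra.ι ℝ U x) = g (SymmetricAlgebra.ι ℝ U x)) : f = g := by
  refine AlgHom.ext fun a => ?_
  induction a using SymmetricAlgebra.induction with
  | algebraMap r => simp only [AlgHom.commutes]
  | ι x => exact h x
  | mul a b ha hb => rw [map_mul, map_mul, ha, hb]
  | add a b ha hb => rw [map_add, map_add, ha, hb]

variable {V : Type*} [AddCommGroup V] [Module ℝ V] {m : Type*}

/-- A polynomial on `V`, written in the linear coordinates given by a basis `X`. -/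
def coordPoly [Fintype m] [DecidableEq m] (X : Module.Basis m ℝ V) :
    SymmetricAlgebra ℝ (Module.Dual ℝ V) ≃ₐ[ℝ] MvPolynomial m ℝ :=
  SymmetricAlgebra.equivMvPolynomial X.dualBasis

theorem coordPoly_symm_X [Fintype m] [DecidableEq m] (X : Module.Basis m ℝ V) (i : m) :
    (coordPoly X).symm (MvPolynomial.X i) = SymmetricAlgebra.ι ℝ _ (X.coord i) := by
  rw [coordPoly, SymmetricAlgebra.equivMvPolynomial_symm_X, Module.Basis.coe_dualBasis]

theorem eval_coordPoly [Fintype m] [DecidableEq m] (X : Module.Basis m ℝ V)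
    (f : SymmetricAlgebra ℝ (Module.Dual ℝ V)) (x : V) :
    MvPolynomial.eval (X.repr x) (coordPoly X f) = polyFun f x := by
  have h : ((MvPolynomial.aeval (R := ℝ) (X.repr x : m → ℝ)).comp
      (coordPoly X : SymmetricAlgebra ℝ (Module.Dual ℝ V) →ₐ[ℝ] MvPolynomial m ℝ)) =
      SymmetricAlgebra.lift (Module.Dual.eval ℝ V x) := by
    refine symmetricAlgebra_algHom_ext fun ξ => ?_
    rw [SymmetricAlgebra.lift_ι_apply]
    rw [← X.dualBasis.sum_repr ξ]
    simp only [map_sum, map_smul]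
    refine Finset.sum_congr rfl fun i _ => ?_
    have h : coordPoly X (SymmetricAlgebra.ι ℝ _ (X.dualBasis i)) = MvPolynomial.X i :=
      SymmetricAlgebra.equivMvPolynomial_ι_apply _ _
    have h' := congrArg (MvPolynomial.aeval (R := ℝ) (X.repr x : m → ℝ)) h
    refine congrArg _ (h'.trans ?_)
    simp
  have := DFunLike.congr_fun h f
  simpa [polyFun, MvPolynomial.coe_aeval_eq_eval] using this

/-- A polynomial on a finite-dimensional real vector space is determined by its values. -/
theorem polyFun_injective [FiniteDimensional ℝ V] :
    Function.Injective (polyFun : SymmetricAlgebra ℝ (Module.Dual ℝ V) → V → ℝ) := by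
  intro f g h
  let X := Module.finBasis ℝ V
  apply (coordPoly X).injective
  refine MvPolynomial.funext fun x => ?_
  have := congrFun h (X.equivFun.symm x)
  rw [← eval_coordPoly X, ← eval_coordPoly X] at this
  have hx : ⇑(X.repr (X.equivFun.symm x)) = x := X.equivFun.apply_symm_apply x
  rwa [hx] at this

/-- The value at `0` of `∑ N_{j_1} ⋯ N_{j_r} ∂_{j_1} ⋯ ∂_{j_r} p`. -/
def taylorTerm [Fintype m] {A : Type*} [Ring A] [Algebra ℝ A] (N : m → A) (r : ℕ)
    (p : MvPolynomial m ℝ) : A :=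
  ∑ j : Fin r → m,
    MvPolynomial.eval 0 ((List.ofFn j).foldr (fun i q => MvPolynomial.pderiv i q) p) •
      (List.ofFn fun l => N (j l)).prod

theorem foldr_pderiv_comm [DecidableEq m] (l : List m) (i : m) (p : MvPolynomial m ℝ) :
    MvPolynomial.pderiv i (l.foldr (fun i q => MvPolynomial.pderiv i q) p) =
      l.foldr (fun i q => MvPolynomial.pderiv (R := ℝ) i q) (MvPolynomial.pderiv i p) := by
  induction l with
  | nil => rfl
  | cons j l ih =>
    rw [List.foldr_cons, List.foldr_cons, ← ih]
    have : ⁅MvPolynomial.pderiv (R := ℝ) i, MvPolynomial.pderiv (R := ℝ) j⁆ = 0 := by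
      refine MvPolynomial.derivation_ext fun k => ?_
      rw [Derivation.commutator_apply]
      simp [MvPolynomial.pderiv_X, Pi.single_apply, apply_ite]
    have h := DFunLike.congr_fun this (l.foldr (fun i q => MvPolynomial.pderiv i q) p)
    rw [Derivation.commutator_apply] at h
    exact sub_eq_zero.1 h

theorem taylorTerm_add [Fintype m] {A : Type*} [Ring A] [Algebra ℝ A] (N : m → A) (r : ℕ)
    (p q : MvPolynomial m ℝ) : taylorTerm N r (p + q) = taylorTerm N r p + taylorTerm N r q := by
  have h : ∀ l : List m, l.foldr (fun i q => MvPolynomial.pderiv i q) (p + q) =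
      l.foldr (fun i q => MvPolynomial.pderiv i q) p +
        l.foldr (fun i q => MvPolynomial.pderiv i q) q := by
    intro l
    induction l with
    | nil => rfl
    | cons j l ih => simp only [List.foldr_cons, ih, map_add]
  simp only [taylorTerm, h, map_add, add_smul, Finset.sum_add_distrib]

theorem taylorTerm_succ [Fintype m] [DecidableEq m] {A : Type*} [Ring A] [Algebra ℝ A]
    (N : m → A) (r : ℕ) (p : MvPolynomial m ℝ) :
    taylorTerm N (r + 1) p = ∑ i, N i * taylorTerm N r (MvPolynomial.pderiv i p) := by
  unfold taylorTerm
  rw [← (Fin.consEquiv fun _ : Fin (r + 1) => m).sum_comp, Fintype.sum_prod_type]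
  refine Finset.sum_congr rfl fun i _ => ?_
  rw [Finset.mul_sum]
  refine Finset.sum_congr rfl fun j _ => ?_
  simp only [Fin.consEquiv_apply, List.ofFn_succ, Fin.cons_zero, Fin.cons_succ, List.foldr_cons,
    List.prod_cons, foldr_pderiv_comm, mul_smul_comm]

theorem taylorTerm_zero [Fintype m] {A : Type*} [Ring A] [Algebra ℝ A] (N : m → A)
    (p : MvPolynomial m ℝ) :
    taylorTerm N 0 p = algebraMap ℝ A (MvPolynomial.eval 0 p) := by
  simp [taylorTerm, Algebra.algebraMap_eq_smul_one]

theorem taylorTerm_const [Fintype m] [DecidableEq m] {A : Type*} [Ring A] [Algebra ℝ A]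
    (N : m → A) (r : ℕ) (c : ℝ) :
    taylorTerm N (r + 1) (MvPolynomial.C c) = 0 := by
  rw [taylorTerm_succ]
  refine Finset.sum_eq_zero fun i _ => ?_
  rw [MvPolynomial.pderiv_C]
  have h := taylorTerm_add N r 0 0
  rw [add_zero] at h
  rw [left_eq_add.1 h, mul_zero]

/-- At the origin only the terms in which exactly one derivative hits the coordinate `x_i`
survive. -/
theorem taylorTerm_X_mul [Fintype m] [DecidableEq m] {A : Type*} [Ring A] [Algebra ℝ A] (N : m → A)
    (hN : ∀ i j, Commute (N i) (N j)) (i : m) (r : ℕ) (p : MvPolynomial m ℝ) :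
    taylorTerm N (r + 1) (MvPolynomial.X i * p) = ((r : ℝ) + 1) • (N i * taylorTerm N r p) := by
  -- move `x_i` past one derivative at a time
  have step : ∀ (r : ℕ) (p : MvPolynomial m ℝ), taylorTerm N (r + 1) (MvPolynomial.X i * p) =
      N i * taylorTerm N r p +
        ∑ j, N j * taylorTerm N r (MvPolynomial.X i * MvPolynomial.pderiv j p) := by
    intro r p
    rw [taylorTerm_succ]
    have h : ∀ j, N j * taylorTerm N r (MvPolynomial.pderiv j (MvPolynomial.X i * p)) =
        (if j = i then N i * taylorTerm N r p else 0) +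
          N j * taylorTerm N r (MvPolynomial.X i * MvPolynomial.pderiv j p) := by
      intro j
      rw [Derivation.leibniz, smul_eq_mul, smul_eq_mul, taylorTerm_add, mul_add, add_comm]
      congr 1
      rw [MvPolynomial.pderiv_X, Pi.single_apply]
      split_ifs with hij hji hji
      · subst hij; rw [mul_one]
      · exact absurd hij.symm hji
      · exact absurd hji.symm hij
      · have h0 := taylorTerm_add N r 0 0
        rw [add_zero] at h0
        rw [mul_zero, left_eq_add.1 h0, mul_zero]
    rw [Finset.sum_congr rfl fun j _ => h j, Finset.sum_add_distrib]
    simp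
  induction r generalizing p with
  | zero =>
    rw [step]
    have h : ∀ j, taylorTerm N 0 (MvPolynomial.X i * MvPolynomial.pderiv j p) = 0 := by
      intro j
      simp [taylorTerm_zero]
    simp [h]
  | succ r ih =>
    rw [step, Finset.sum_congr rfl fun j _ => by rw [ih (MvPolynomial.pderiv j p)]]
    have h : ∀ j, N j * (((r : ℝ) + 1) • (N i * taylorTerm N r (MvPolynomial.pderiv j p))) =
        ((r : ℝ) + 1) • (N i * (N j * taylorTerm N r (MvPolynomial.pderiv j p))) := by
      intro j
      rw [mul_smul_comm, ← mul_assoc, ← mul_assoc, (hN j i).eq]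
    rw [Finset.sum_congr rfl fun j _ => h j, ← Finset.smul_sum, ← Finset.mul_sum,
      ← taylorTerm_succ]
    push_cast
    rw [add_smul ((r : ℝ) + 1) 1, one_smul, add_comm]

/-- The Taylor formula for polynomials: substituting commuting elements `N_i` for the coordinates
is the same as applying `exp (∑ N_i ∂_i)` and evaluating at the origin. -/
theorem exists_sum_taylorTerm [Fintype m] [DecidableEq m] {A : Type*} [Ring A] [Algebra ℝ A]
    (Ψ : MvPolynomial m ℝ →ₐ[ℝ] A) (p : MvPolynomial m ℝ) : ∃ R : ℕ, ∀ n ≥ R, ∑ r ∈ Finset.range n,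
      (r.factorial : ℝ)⁻¹ • taylorTerm (fun i => Ψ (MvPolynomial.X i)) r p = Ψ p := by
  induction p using MvPolynomial.induction_on with
  | C c =>
    refine ⟨1, fun n hn => ?_⟩
    obtain ⟨n, rfl⟩ := Nat.exists_eq_add_of_le' hn
    rw [Finset.sum_range_succ']
    simp only [taylorTerm_const, taylorTerm_zero]
    simp [← MvPolynomial.algebraMap_eq]
  | add p q hp hq =>
    obtain ⟨R, hR⟩ := hp
    obtain ⟨S, hS⟩ := hq
    refine ⟨max R S, fun n hn => ?_⟩
    simp only [taylorTerm_add, smul_add, Finset.sum_add_distrib]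
    rw [hR n (le_of_max_le_left hn), hS n (le_of_max_le_right hn), map_add]
  | mul_X p i hp =>
    obtain ⟨R, hR⟩ := hp
    refine ⟨R + 1, fun n hn => ?_⟩
    obtain ⟨n, rfl⟩ := Nat.exists_eq_add_of_le' (le_of_add_le_right hn)
    rw [Finset.sum_range_succ', mul_comm p, map_mul, ← hR n (by omega), Finset.mul_sum]
    have h0 : taylorTerm (fun i => Ψ (MvPolynomial.X i)) 0 (MvPolynomial.X i * p) = 0 := by
      simp [taylorTerm_zero]
    rw [h0, smul_zero, add_zero]
    refine Finset.sum_congr rfl fun r _ => ?_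
    rw [taylorTerm_X_mul _ fun i j => (Commute.all (MvPolynomial.X i) (MvPolynomial.X j)).map Ψ,
      mul_smul_comm, smul_smul, Nat.factorial_succ]
    congr 1
    push_cast
    have : ((r : ℝ) + 1) ≠ 0 := by positivity
    field_simp

theorem finsum_taylorTerm [Fintype m] [DecidableEq m] {A : Type*} [Ring A] [Algebra ℝ A]
    (Ψ : MvPolynomial m ℝ →ₐ[ℝ] A) (p : MvPolynomial m ℝ) :
    ∑ᶠ r : ℕ, (r.factorial : ℝ)⁻¹ • taylorTerm (fun i => Ψ (MvPolynomial.X i)) r p = Ψ p := by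
  obtain ⟨R, hR⟩ := exists_sum_taylorTerm Ψ p
  have hzero : ∀ r ≥ R, (r.factorial : ℝ)⁻¹ •
      taylorTerm (fun i => Ψ (MvPolynomial.X i)) r p = 0 := by
    intro r hr
    have h1 := hR (r + 1) (by omega)
    rwa [Finset.sum_range_succ, hR r hr, add_eq_left] at h1
  rw [finsum_eq_sum_of_support_subset (s := Finset.range R), hR R le_rfl]
  intro r hr
  by_contra h
  exact hr (hzero r (by simpa using h))

theorem hasLineDerivAt_eval [Fintype m] [DecidableEq m] (X : Module.Basis m ℝ V)
    (p : MvPolynomial m ℝ) (x : V) (j : m) :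
    HasLineDerivAt ℝ (fun y => ((MvPolynomial.eval (X.repr y) p : ℝ) : ℂ))
      ((MvPolynomial.eval (X.repr x) (MvPolynomial.pderiv j p) : ℝ) : ℂ) x (X j) := by
  have h : HasDerivAt (fun t : ℝ => MvPolynomial.eval (X.repr (x + t • X j)) p)
      (MvPolynomial.eval (X.repr x) (MvPolynomial.pderiv j p)) 0 := by
    induction p using MvPolynomial.induction_on with
    | C c => simpa using hasDerivAt_const (0 : ℝ) c
    | add p q hp hq => simpa only [map_add] using! hp.add hq
    | mul_X p i hp =>
      have h1 : HasDerivAt (fun t : ℝ => X.repr (x + t • X j) i)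
          ((Pi.single j 1 : m → ℝ) i) 0 := by
        have : (fun t : ℝ => X.repr (x + t • X j) i) =
            fun t : ℝ => X.repr x i + t * (Pi.single j 1 : m → ℝ) i := by
          funext t
          simp [Finsupp.single_apply, Pi.single_apply, eq_comm]
        rw [this]
        simpa using ((hasDerivAt_id (0 : ℝ)).mul_const ((Pi.single j 1 : m → ℝ) i)).const_add
          (X.repr x i)
      have h2 := hp.mul h1
      simp only [map_mul, MvPolynomial.eval_X]
      refine h2.congr_deriv ?_
      simp only [Derivation.leibniz, smul_eq_mul, map_add, map_mul, MvPolynomial.eval_X,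
        MvPolynomial.pderiv_X]
      simp only [zero_smul, map_zero, add_zero]
      rw [Pi.single_apply, Pi.single_apply]
      simp only [eq_comm (a := i), apply_ite (MvPolynomial.eval _), map_one, map_zero]
      ring
  exact h.ofReal_comp

end Polynomials

/-! ### Forms on vector spaces -/

section CForms

variable {V W Z : Type*} [AddCommGroup V] [Module ℝ V] [AddCommGroup W] [Module ℝ W]
  [AddCommGroup Z] [Module ℝ Z]

theorem CForms.pull_tmul (L : V →ₗ[ℝ] W) (z : ℂ) (a : ExteriorAlgebra ℝ (Module.Dual ℝ W)) :
    CForms.pull L (z ⊗ₜ[ℝ] a) = z ⊗ₜ[ℝ] ExteriorAlgebra.map L.dualMap a := rfl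

theorem CForms.pull_comp_apply (L : V →ₗ[ℝ] W) (M : W →ₗ[ℝ] Z) (a : CForms Z) :
    CForms.pull (M ∘ₗ L) a = CForms.pull L (CForms.pull M a) := by
  induction a using TensorProduct.induction_on with
  | zero => simp
  | add a b ha hb => rw [map_add, map_add, map_add, ha, hb]
  | tmul z a =>
    rw [CForms.pull_tmul, CForms.pull_tmul, CForms.pull_tmul, ← LinearMap.dualMap_comp_dualMap,
      ← ExteriorAlgebra.map_comp_map]
    rfl

theorem CForms.pull_id_apply (a : CForms V) : CForms.pull LinearMap.id a = a := by
  induction a using TensorProduct.induction_on with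
  | zero => simp
  | add a b ha hb => rw [map_add, ha, hb]
  | tmul z a => rw [CForms.pull_tmul, LinearMap.dualMap_id, ExteriorAlgebra.map_id]; rfl

/-- A right inverse of `L` gives a left inverse of the pullback. -/
theorem CForms.pull_injective {L : V →ₗ[ℝ] W} (hL : Function.Surjective L) :
    Function.Injective (CForms.pull L) := by
  obtain ⟨R, hR⟩ := L.exists_rightInverse_of_surjective (LinearMap.range_eq_top.2 hL)
  intro a b h
  rw [← CForms.pull_id_apply a, ← CForms.pull_id_apply b, ← hR, CForms.pull_comp_apply,
    CForms.pull_comp_apply, h]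

/-- Pulling back a two-form: the formula for a pair of bases. -/
theorem map_sum_coord_mul_coord {ι κ : Type*} [Fintype ι] [Fintype κ] (e : Module.Basis ι ℝ V)
    (h : Module.Basis κ ℝ W) (L : V →ₗ[ℝ] W) (β : W →ₗ[ℝ] W →ₗ[ℝ] ℝ) :
    ExteriorAlgebra.map L.dualMap (∑ a, ∑ b, β (h a) (h b) •
      (ExteriorAlgebra.ι ℝ (h.coord a) * ExteriorAlgebra.ι ℝ (h.coord b))) =
    ∑ a, ∑ b, β (L (e a)) (L (e b)) •
      (ExteriorAlgebra.ι ℝ (e.coord a) * ExteriorAlgebra.ι ℝ (e.coord b)) := by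
  classical
  -- a covector is the sum of its values on a basis times the dual basis
  have hL : ∀ a, L.dualMap (h.coord a) = ∑ c, h.coord a (L (e c)) • e.coord c := by
    intro a
    refine e.ext fun c => ?_
    simp [Finsupp.single_apply]
  have hβ : ∀ c d, β (L (e c)) (L (e d)) =
      ∑ a, ∑ b, h.coord a (L (e c)) * h.coord b (L (e d)) * β (h a) (h b) := by
    intro c d
    conv_lhs => rw [← h.sum_repr (L (e c)), ← h.sum_repr (L (e d))]
    simp only [map_sum, map_smul, LinearMap.sum_apply, LinearMap.smul_apply, smul_eq_mul,
      Module.Basis.coord_apply, Finset.mul_sum]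
    rw [Finset.sum_comm]
    refine Finset.sum_congr rfl fun a _ => Finset.sum_congr rfl fun b _ => by ring
  simp only [map_sum, map_smul, map_mul, ExteriorAlgebra.map_apply_ι, hL, hβ, Finset.sum_mul,
    Finset.mul_sum, Finset.smul_sum, Finset.sum_smul, smul_mul_assoc, mul_smul_comm, smul_smul]
  rw [Finset.sum_congr rfl fun a _ => Finset.sum_comm]
  rw [Finset.sum_comm]
  rw [Finset.sum_congr rfl fun a _ => Finset.sum_congr rfl fun b _ => Finset.sum_comm]
  rw [Finset.sum_congr rfl fun a _ => Finset.sum_comm]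
  rw [Finset.sum_comm]
  refine Finset.sum_congr rfl fun a _ => Finset.sum_congr rfl fun b _ =>
    Finset.sum_congr rfl fun c _ => Finset.sum_congr rfl fun d _ => ?_
  congr 1
  ring

/-- The element of the exterior algebra attached to a two-form may be computed in any basis. -/
theorem ofTwoForm_eq_sum [FiniteDimensional ℝ V] {ι : Type*} [Fintype ι]
    (e : Module.Basis ι ℝ V) (β : V →ₗ[ℝ] V →ₗ[ℝ] ℝ) :
    ofTwoForm (fun v w => β v w) = (1 / 2 : ℝ) • ∑ a, ∑ b, β (e a) (e b) •
      (ExteriorAlgebra.ι ℝ (e.coord a) * ExteriorAlgebra.ι ℝ (e.coord b)) := by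
  have h := map_sum_coord_mul_coord e (Module.finBasis ℝ V) LinearMap.id β
  rw [LinearMap.dualMap_id, ExteriorAlgebra.map_id, AlgHom.id_apply] at h
  rw [ofTwoForm, h]
  rfl

theorem map_ofTwoForm [FiniteDimensional ℝ V] [FiniteDimensional ℝ W] (L : V →ₗ[ℝ] W)
    (β : W →ₗ[ℝ] W →ₗ[ℝ] ℝ) :
    ExteriorAlgebra.map L.dualMap (ofTwoForm fun v w => β v w) =
      ofTwoForm fun v w => β (L v) (L w) := by
  rw [ofTwoForm, map_smul, map_sum_coord_mul_coord (Module.finBasis ℝ V)]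
  rfl

instance CForms.instFiniteDimensional [FiniteDimensional ℝ V] :
    FiniteDimensional ℝ (CForms V) := by
  have : Module.Finite ℝ (ExteriorAlgebra ℝ (Module.Dual ℝ V)) :=
    Module.Finite.of_basis (Module.finBasis ℝ (Module.Dual ℝ V)).ExteriorAlgebra
  infer_instance

end CForms

/-! ### Submersions, immersions and locally constant functions -/

section Manifolds

open Topology Filter

variable {E : Type*} [NormedAddCommGroup E] [NormedSpace ℝ E]
  {M : Type*} [TopologicalSpace M] [ChartedSpace E M]
  {E' : Type*} [NormedAddCommGroup E'] [NormedSpace ℝ E']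
  {N : Type*} [TopologicalSpace N] [ChartedSpace E' N]

/-- A submersion at `x` has a local section, smooth at `f x`, through `x`. -/
theorem exists_local_section [IsManifold 𝓘(ℝ, E) ∞ M] [IsManifold 𝓘(ℝ, E') ∞ N]
    {f : M → N} {x : M} (hf : Manifold.IsSubmersionAt 𝓘(ℝ, E) 𝓘(ℝ, E') ∞ f x) :
    ∃ s : N → M, s (f x) = x ∧ ContMDiffAt 𝓘(ℝ, E') 𝓘(ℝ, E) ∞ s (f x) ∧
      ∀ᶠ y in 𝓝 (f x), f (s y) = y := by
  have hx := hf.mem_domChart_source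
  have hfx := hf.mem_codChart_source
  have hw := hf.writtenInCharts
  simp only [mfld_simps] at hw
  set φ := hf.domChart with hφ
  set ψ := hf.codChart with hψ
  set e := hf.equiv
  -- move in the chart along the first factor only
  let j : E' → E := fun u => e.symm (u, (e (φ x)).2)
  have hj : ContDiff ℝ ∞ j := by fun_prop
  have hw' : ∀ z ∈ φ.target, ψ (f (φ.symm z)) = (e z).1 := fun z hz => hw hz
  have h1 : (e (φ x)).1 = ψ (f x) := by
    rw [← hw' _ (φ.map_source hx), φ.left_inv hx]
  have hjx : j (ψ (f x)) = φ x := by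
    simp only [j, ← h1]; exact e.symm_apply_apply _
  have hc : ContMDiffAt 𝓘(ℝ, E') 𝓘(ℝ, E) ∞ (φ.symm ∘ j ∘ ψ) (f x) := by
    refine ContMDiffAt.comp (f x) (I' := 𝓘(ℝ, E)) ?_ (ContMDiffAt.comp (f x) (I' := 𝓘(ℝ, E')) ?_ ?_)
    · refine contMDiffAt_symm_of_mem_maximalAtlas hf.domChart_mem_maximalAtlas ?_
      rw [Function.comp_apply, hjx]
      exact φ.map_source hx
    · exact hj.contDiffAt.contMDiffAt
    · exact contMDiffAt_of_mem_maximalAtlas hf.codChart_mem_maximalAtlas hfx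
  refine ⟨φ.symm ∘ j ∘ ψ, ?_, hc, ?_⟩
  · simp only [Function.comp_apply, hjx, φ.left_inv hx]
  · have h2 : ∀ᶠ y in 𝓝 (f x), j (ψ y) ∈ φ.target := by
      have : ContinuousAt (fun y => j (ψ y)) (f x) :=
        hj.continuous.continuousAt.comp (ψ.continuousAt hfx)
      refine this.preimage_mem_nhds (φ.open_target.mem_nhds ?_)
      rw [hjx]
      exact φ.map_source hx
    filter_upwards [h2, ψ.open_source.mem_nhds hfx] with y hy hyψ
    have h3 : φ.symm (j (ψ y)) ∈ φ.source := φ.map_target hy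
    refine ψ.injOn (hf.source_subset_preimage_source h3) hyψ ?_
    rw [hw' _ hy]
    simp [j]

theorem mfderiv_surjective_of_isSubmersionAt [IsManifold 𝓘(ℝ, E) ∞ M] [IsManifold 𝓘(ℝ, E') ∞ N]
    {f : M → N} {x : M} (hf : Manifold.IsSubmersionAt 𝓘(ℝ, E) 𝓘(ℝ, E') ∞ f x) :
    Function.Surjective (mfderiv 𝓘(ℝ, E) 𝓘(ℝ, E') f x) := by
  obtain ⟨s, hsx, hs, hfs⟩ := exists_local_section hf
  have hfd : MDifferentiableAt 𝓘(ℝ, E) 𝓘(ℝ, E') f (s (f x)) := by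
    rw [hsx]
    exact hf.isSubmersionAtOfComplement_complement.contMDiffAt.mdifferentiableAt (by simp)
  have h := mfderiv_comp (f x) hfd (hs.mdifferentiableAt (by simp))
  have hid : mfderiv 𝓘(ℝ, E') 𝓘(ℝ, E') (f ∘ s) (f x) = ContinuousLinearMap.id ℝ _ := by
    rw [← mfderiv_id]
    exact EventuallyEq.mfderiv_eq hfs
  rw [hid] at h
  rw [hsx] at h
  intro w
  exact ⟨mfderiv 𝓘(ℝ, E') 𝓘(ℝ, E) s (f x) w, (DFunLike.congr_fun h w).symm⟩

/-- Every vector that a submersion kills is the velocity of a curve in its fibre. -/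
theorem exists_curve_in_fibre [IsManifold 𝓘(ℝ, E) ∞ M] [IsManifold 𝓘(ℝ, E') ∞ N]
    {f : M → N} {x : M} (hf : Manifold.IsSubmersionAt 𝓘(ℝ, E) 𝓘(ℝ, E') ∞ f x)
    (v : TangentSpace 𝓘(ℝ, E) x)
    (hv : mfderiv 𝓘(ℝ, E) 𝓘(ℝ, E') f x v = 0) :
    ∃ c : ℝ → M, c 0 = x ∧ MDifferentiableAt 𝓘(ℝ, ℝ) 𝓘(ℝ, E) c 0 ∧
      (mfderiv 𝓘(ℝ, ℝ) 𝓘(ℝ, E) c 0 (1 : ℝ) : E) = v ∧ ∀ᶠ t in 𝓝 (0 : ℝ), f (c t) = f x := by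
  have hx := hf.mem_domChart_source
  have hfx := hf.mem_codChart_source
  have hw := hf.writtenInCharts
  simp only [mfld_simps] at hw
  set φ := hf.domChart with hφ
  set ψ := hf.codChart with hψ
  set e := hf.equiv
  have hw' : ∀ z ∈ φ.target, ψ (f (φ.symm z)) = (e z).1 := fun z hz => hw hz
  have hφd : MDifferentiableAt 𝓘(ℝ, E) 𝓘(ℝ, E) φ x :=
    (contMDiffAt_of_mem_maximalAtlas hf.domChart_mem_maximalAtlas hx).mdifferentiableAt (by simp)
  have hψd : MDifferentiableAt 𝓘(ℝ, E') 𝓘(ℝ, E') ψ (f x) :=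
    (contMDiffAt_of_mem_maximalAtlas hf.codChart_mem_maximalAtlas hfx).mdifferentiableAt (by simp)
  have hφs : MDifferentiableAt 𝓘(ℝ, E) 𝓘(ℝ, E) φ.symm (φ x) :=
    (contMDiffAt_symm_of_mem_maximalAtlas hf.domChart_mem_maximalAtlas
      (φ.map_source hx)).mdifferentiableAt (by simp)
  have hfd : MDifferentiableAt 𝓘(ℝ, E) 𝓘(ℝ, E') f x :=
    hf.isSubmersionAtOfComplement_complement.contMDiffAt.mdifferentiableAt (by simp)
  let v' : E := mfderiv 𝓘(ℝ, E) 𝓘(ℝ, E) φ x v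
  -- the velocity in the chart lies in the second factor
  have hv' : (e v').1 = 0 := by
    have h1 : ψ ∘ f =ᶠ[𝓝 x] (fun z => (e z).1) ∘ φ := by
      filter_upwards [φ.open_source.mem_nhds hx] with y hy
      rw [Function.comp_apply, Function.comp_apply, ← hw' _ (φ.map_source hy), φ.left_inv hy]
    have h2 := h1.mfderiv_eq (I := 𝓘(ℝ, E)) (I' := 𝓘(ℝ, E'))
    rw [mfderiv_comp x hψd hfd] at h2
    let A : E →L[ℝ] E' := (ContinuousLinearMap.fst ℝ _ _).comp (e : E →L[ℝ] E' × hf.complement)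
    have h3 : (fun z => (e z).1) = A := rfl
    rw [h3, mfderiv_comp x A.differentiableAt.mdifferentiableAt hφd] at h2
    have h4 := DFunLike.congr_fun h2 v
    have h5 : mfderiv 𝓘(ℝ, E) 𝓘(ℝ, E') A (φ x) = A := by
      rw [mfderiv_eq_fderiv]; exact A.fderiv
    rw [h5] at h4
    refine (Eq.symm h4).trans ?_
    rw [ContinuousLinearMap.comp_apply, hv]
    exact map_zero _
  -- the straight line in the chart stays in the fibre
  let l : ℝ → E := fun t => φ x + t • v'
  have hl : HasDerivAt l v' 0 := by
    simpa [l] using ((hasDerivAt_id (0 : ℝ)).smul_const v').const_add (φ x)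
  have hl0 : l 0 = φ x := by simp [l]
  have hlm : MDifferentiableAt 𝓘(ℝ, ℝ) 𝓘(ℝ, E) l 0 :=
    hl.differentiableAt.mdifferentiableAt
  have hφs' : MDifferentiableAt 𝓘(ℝ, E) 𝓘(ℝ, E) φ.symm (l 0) := by rw [hl0]; exact hφs
  refine ⟨φ.symm ∘ l, ?_, hφs'.comp 0 hlm, ?_, ?_⟩
  · rw [Function.comp_apply, hl0, φ.left_inv hx]
  · rw [mfderiv_comp 0 hφs' hlm]
    have h1 : mfderiv 𝓘(ℝ, ℝ) 𝓘(ℝ, E) l 0 (1 : ℝ) = v' := by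
      rw [mfderiv_eq_fderiv]
      exact hl.deriv
    have h2 : (mfderiv 𝓘(ℝ, E) 𝓘(ℝ, E) φ.symm (φ x)).comp (mfderiv 𝓘(ℝ, E) 𝓘(ℝ, E) φ x) =
        mfderiv 𝓘(ℝ, E) 𝓘(ℝ, E) (φ.symm ∘ φ) x := (mfderiv_comp x hφs hφd).symm
    have h3 : mfderiv 𝓘(ℝ, E) 𝓘(ℝ, E) (φ.symm ∘ φ) x = mfderiv 𝓘(ℝ, E) 𝓘(ℝ, E) (id : M → M) x := by
      refine EventuallyEq.mfderiv_eq ?_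
      filter_upwards [φ.open_source.mem_nhds hx] with y hy using φ.left_inv hy
    have h4 := DFunLike.congr_fun (h2.trans h3) v
    rw [mfderiv_id] at h4
    have h5 := congrArg (mfderiv 𝓘(ℝ, E) 𝓘(ℝ, E) φ.symm (l 0)) h1
    refine Eq.trans h5 ?_
    rw [hl0]
    exact h4
  · have h1 : ∀ᶠ t in 𝓝 (0 : ℝ), l t ∈ φ.target := by
      refine hl.continuousAt.preimage_mem_nhds (φ.open_target.mem_nhds ?_)
      rw [hl0]
      exact φ.map_source hx
    filter_upwards [h1] with t ht
    refine ψ.injOn (hf.source_subset_preimage_source (φ.map_target ht)) hfx ?_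
    rw [hw' _ ht]
    have h2 := hw' _ (φ.map_source hx)
    rw [φ.left_inv hx] at h2
    rw [h2]
    simp [l, hv']

/-- The velocity of a curve inside an embedded submanifold is tangent to it; only the immersion
property at the point and the topology of the submanifold enter. -/
theorem exists_mfderiv_eq_of_curve [IsManifold 𝓘(ℝ, E) ∞ M] [IsManifold 𝓘(ℝ, E') ∞ N]
    {f : M → N} {x : M} (hf : Manifold.IsImmersionAt 𝓘(ℝ, E) 𝓘(ℝ, E') ∞ f x) (hi : IsInducing f)
    {c : ℝ → N} (hc0 : c 0 = f x) (hc : MDifferentiableAt 𝓘(ℝ, ℝ) 𝓘(ℝ, E') c 0)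
    (hcf : ∀ᶠ t in 𝓝 (0 : ℝ), c t ∈ Set.range f) :
    ∃ u : TangentSpace 𝓘(ℝ, E) x,
      (mfderiv 𝓘(ℝ, E) 𝓘(ℝ, E') f x u : E') = mfderiv 𝓘(ℝ, ℝ) 𝓘(ℝ, E') c 0 (1 : ℝ) := by
  have hx := hf.mem_domChart_source
  have hfx := hf.mem_codChart_source
  have hw := hf.writtenInCharts
  simp only [mfld_simps] at hw
  set φ := hf.domChart with hφ
  set ψ := hf.codChart with hψ
  set e := hf.equiv
  have hw' : ∀ y ∈ φ.source, ψ (f y) = e (φ y, 0) := fun y hy => by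
    have := hw (φ.map_source hy)
    simpa [φ.left_inv hy] using this
  -- a smooth left inverse of `f` near `f x`
  let ρ : N → M := φ.symm ∘ (fun z => (e.symm z).1) ∘ ψ
  have hρ : ∀ y ∈ φ.source, ρ (f y) = y := fun y hy => by
    simp only [ρ, Function.comp_apply, hw' y hy, e.symm_apply_apply, φ.left_inv hy]
  have hρx : (e.symm (ψ (f x))).1 = φ x := by simp [hw' x hx]
  have hρd : MDifferentiableAt 𝓘(ℝ, E') 𝓘(ℝ, E) ρ (c 0) := by
    rw [hc0]
    have h : ContMDiffAt 𝓘(ℝ, E') 𝓘(ℝ, E) ∞ ρ (f x) := by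
      refine ContMDiffAt.comp (f x) (I' := 𝓘(ℝ, E)) ?_
        (ContMDiffAt.comp (f x) (I' := 𝓘(ℝ, E')) ?_ ?_)
      · refine contMDiffAt_symm_of_mem_maximalAtlas hf.domChart_mem_maximalAtlas ?_
        simp only [Function.comp_apply]
        rw [hρx]
        exact φ.map_source hx
      · have : ContDiff ℝ ∞ fun z => (e.symm z).1 := by fun_prop
        exact this.contDiffAt.contMDiffAt
      · exact contMDiffAt_of_mem_maximalAtlas hf.codChart_mem_maximalAtlas hfx
    exact h.mdifferentiableAt (by simp)
  -- the curve lifts along `f`; this uses that `f` carries the induced topology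
  have hcρ : c =ᶠ[𝓝 (0 : ℝ)] f ∘ (ρ ∘ c) := by
    obtain ⟨U, hU, hUφ⟩ := hi.isOpen_iff.1 φ.open_source
    have h0 : c 0 ∈ U := by
      rw [hc0]
      exact (hUφ.symm ▸ hx : x ∈ f ⁻¹' U)
    filter_upwards [hcf, hc.continuousAt.preimage_mem_nhds (hU.mem_nhds h0)] with t ht htU
    obtain ⟨k, hk⟩ := ht
    have hk' : k ∈ φ.source := by
      rw [← hUφ]
      show f k ∈ U
      rw [hk]; exact htU
    rw [Function.comp_apply, Function.comp_apply, ← hk, hρ k hk']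
  have hρ0 : ρ (c 0) = x := by rw [hc0, hρ x hx]
  have hρc := hρd.comp 0 hc
  have hfd : MDifferentiableAt 𝓘(ℝ, E) 𝓘(ℝ, E') f ((ρ ∘ c) 0) := by
    rw [Function.comp_apply, hρ0]
    exact hf.isImmersionAtOfComplement_complement.contMDiffAt.mdifferentiableAt (by simp)
  have h := hcρ.mfderiv_eq (I := 𝓘(ℝ, ℝ)) (I' := 𝓘(ℝ, E'))
  rw [mfderiv_comp 0 hfd hρc] at h
  refine ⟨(mfderiv 𝓘(ℝ, ℝ) 𝓘(ℝ, E) (ρ ∘ c) 0 (1 : ℝ) : E), ?_⟩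
  have hxx : ∀ x' : M, x' = x → ∀ a : E, (mfderiv 𝓘(ℝ, E) 𝓘(ℝ, E') f x a : E') =
      mfderiv 𝓘(ℝ, E) 𝓘(ℝ, E') f x' a := by
    rintro _ rfl a
    rfl
  rw [h]
  exact hxx _ hρ0 _

/-- A function with vanishing differential on a connected manifold is constant. -/
theorem eq_of_mfderiv_eq_zero [IsManifold 𝓘(ℝ, E) ∞ M] [PreconnectedSpace M] {W : Type*}
    [NormedAddCommGroup W] [NormedSpace ℝ W] {f : M → W}
    (hf : ∀ x, HasMFDerivAt 𝓘(ℝ, E) 𝓘(ℝ, W) f x 0) (x y : M) : f x = f y := by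
  have hlc : IsLocallyConstant f := by
    rw [IsLocallyConstant.iff_eventually_eq]
    intro x
    let φ := extChartAt 𝓘(ℝ, E) x
    have hopen : IsOpen φ.target := isOpen_extChartAt_target x
    obtain ⟨r, hr, hball⟩ := Metric.isOpen_iff.1 hopen (φ x) (mem_extChartAt_target x)
    have hd : ∀ z ∈ φ.target, HasFDerivAt (f ∘ φ.symm) (0 : E →L[ℝ] W) z := by
      intro z hz
      have h1 : MDifferentiableAt 𝓘(ℝ, E) 𝓘(ℝ, E) φ.symm z :=
        (mdifferentiableOn_extChartAt_symm z hz).mdifferentiableAt (hopen.mem_nhds hz)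
      have h2 := (hf (φ.symm z)).comp z h1.hasMFDerivAt
      rw [ContinuousLinearMap.zero_comp] at h2
      exact hasMFDerivAt_iff_hasFDerivAt.1 h2
    have hconst : ∀ z ∈ Metric.ball (φ x) r, (f ∘ φ.symm) z = (f ∘ φ.symm) (φ x) := by
      intro z hz
      refine (convex_ball (φ x) r).is_const_of_fderivWithin_eq_zero (𝕜 := ℝ)
        (fun w hw => (hd w (hball hw)).differentiableAt.differentiableWithinAt) (fun w hw => ?_) hz
        (Metric.mem_ball_self hr)
      rw [fderivWithin_of_isOpen Metric.isOpen_ball hw]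
      exact (hd w (hball hw)).fderiv
    have hc : ContinuousAt φ x := continuousAt_extChartAt x
    filter_upwards [hc.preimage_mem_nhds (Metric.ball_mem_nhds (φ x) hr),
      extChartAt_source_mem_nhds (I := 𝓘(ℝ, E)) x] with y hy hys
    have := hconst _ hy
    simpa only [Function.comp_apply, φ.left_inv hys,
      φ.left_inv (mem_extChartAt_source (I := 𝓘(ℝ, E)) x)] using this
  exact hlc.apply_eq_of_preconnectedSpace x y

end Manifolds

/-! ### Lie brackets in charts -/

section Brackets

open Topology Filter VectorField

variable {E : Type*} [NormedAddCommGroup E] [NormedSpace ℝ E]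
  {M : Type*} [TopologicalSpace M] [ChartedSpace E M]

variable {E' : Type*} [NormedAddCommGroup E'] [NormedSpace ℝ E']
  {N : Type*} [TopologicalSpace N] [ChartedSpace E' N]

/-- On a boundaryless manifold the differential is the derivative in the preferred charts. -/
theorem mfderiv_apply_eq_fderiv {f : M → N} {x : M}
    (hf : MDifferentiableAt 𝓘(ℝ, E) 𝓘(ℝ, E') f x) (u : TangentSpace 𝓘(ℝ, E) x) :
    (mfderiv 𝓘(ℝ, E) 𝓘(ℝ, E') f x u : E') =
      fderiv ℝ (extChartAt 𝓘(ℝ, E') (f x) ∘ f ∘ (extChartAt 𝓘(ℝ, E) x).symm)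
        (extChartAt 𝓘(ℝ, E) x x) u := by
  refine (DFunLike.congr_fun hf.mfderiv u).trans ?_
  show fderivWithin ℝ (extChartAt 𝓘(ℝ, E') (f x) ∘ f ∘ (extChartAt 𝓘(ℝ, E) x).symm)
    (Set.range id) (extChartAt 𝓘(ℝ, E) x x) u = _
  rw [Set.range_id, fderivWithin_univ]

theorem mfderiv_extChartAt_self [IsManifold 𝓘(ℝ, E) ∞ M] (x : M) (v : TangentSpace 𝓘(ℝ, E) x) :
    (mfderiv 𝓘(ℝ, E) 𝓘(ℝ, E) (extChartAt 𝓘(ℝ, E) x) x v : E) = v := by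
  have h : MDifferentiableAt 𝓘(ℝ, E) 𝓘(ℝ, E) (extChartAt 𝓘(ℝ, E) x) x :=
    mdifferentiableAt_extChartAt (mem_chart_source E x)
  have h1 : extChartAt 𝓘(ℝ, E) (extChartAt 𝓘(ℝ, E) x x) ∘ extChartAt 𝓘(ℝ, E) x ∘
      (extChartAt 𝓘(ℝ, E) x).symm =ᶠ[𝓝 (extChartAt 𝓘(ℝ, E) x x)] id := by
    filter_upwards [extChartAt_target_mem_nhds (I := 𝓘(ℝ, E)) x] with z hz
    exact (extChartAt 𝓘(ℝ, E) x).right_inv hz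
  refine (mfderiv_apply_eq_fderiv h v).trans ?_
  rw [h1.fderiv_eq, fderiv_id]
  rfl

theorem mdifferentiableAt_extChartAt_symm [IsManifold 𝓘(ℝ, E) ∞ M] {x : M} {z : E}
    (hz : z ∈ (extChartAt 𝓘(ℝ, E) x).target) :
    MDifferentiableAt 𝓘(ℝ, E) 𝓘(ℝ, E) (extChartAt 𝓘(ℝ, E) x).symm z :=
  (mdifferentiableOn_extChartAt_symm z hz).mdifferentiableAt
    ((isOpen_extChartAt_target x).mem_nhds hz)

theorem mfderiv_dChartSymm [IsManifold 𝓘(ℝ, E) ∞ M] {x : M} {z : E}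
    (hz : z ∈ (extChartAt 𝓘(ℝ, E) x).target) (u : E) :
    mfderiv 𝓘(ℝ, E) 𝓘(ℝ, E) (extChartAt 𝓘(ℝ, E) x) ((extChartAt 𝓘(ℝ, E) x).symm z)
      (dChartSymm x z u) = u := by
  have h := mfderiv_extChartAt_comp_mfderivWithin_extChartAt_symm (I := 𝓘(ℝ, E)) hz
  rw [modelWithCornersSelf_coe, Set.range_id, mfderivWithin_univ] at h
  exact DFunLike.congr_fun h u

theorem dChartSymm_mfderiv [IsManifold 𝓘(ℝ, E) ∞ M] {x : M} {z : E}
    (hz : z ∈ (extChartAt 𝓘(ℝ, E) x).target)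
    (v : TangentSpace 𝓘(ℝ, E) ((extChartAt 𝓘(ℝ, E) x).symm z)) :
    dChartSymm x z (mfderiv 𝓘(ℝ, E) 𝓘(ℝ, E) (extChartAt 𝓘(ℝ, E) x)
      ((extChartAt 𝓘(ℝ, E) x).symm z) v) = v := by
  have h := mfderivWithin_extChartAt_symm_comp_mfderiv_extChartAt (I := 𝓘(ℝ, E)) hz
  rw [modelWithCornersSelf_coe, Set.range_id, mfderivWithin_univ] at h
  exact DFunLike.congr_fun h v

theorem dChartSymm_self [IsManifold 𝓘(ℝ, E) ∞ M] (x : M) (u : E) :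
    (dChartSymm x (extChartAt 𝓘(ℝ, E) x x) u : E) = u := by
  have h := mfderiv_dChartSymm (mem_extChartAt_target (I := 𝓘(ℝ, E)) x) u
  have hx : ∀ y : M, y = x → ∀ v : E,
      (mfderiv 𝓘(ℝ, E) 𝓘(ℝ, E) (extChartAt 𝓘(ℝ, E) x) y v : E) = v := by
    rintro _ rfl v
    exact mfderiv_extChartAt_self _ v
  exact (hx _ (extChartAt_to_inv x) _).symm.trans h

/-- The representation of a vector field in the preferred chart at `x`. -/
def chartField (x : M) (V : Π y : M, TangentSpace 𝓘(ℝ, E) y) : E → E :=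
  mpullbackWithin 𝓘(ℝ, E) 𝓘(ℝ, E) (extChartAt 𝓘(ℝ, E) x).symm V (Set.range 𝓘(ℝ, E))

theorem dChartSymm_chartField [CompleteSpace E] [IsManifold 𝓘(ℝ, E) ∞ M] {x : M} {z : E}
    (hz : z ∈ (extChartAt 𝓘(ℝ, E) x).target) (V : Π y : M, TangentSpace 𝓘(ℝ, E) y) :
    dChartSymm x z (chartField x V z) = V ((extChartAt 𝓘(ℝ, E) x).symm z) := by
  have h := isInvertible_mfderivWithin_extChartAt_symm (I := 𝓘(ℝ, E)) hz
  have h1 : mfderivWithin 𝓘(ℝ, E) 𝓘(ℝ, E) (extChartAt 𝓘(ℝ, E) x).symm (Set.range 𝓘(ℝ, E)) z =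
      dChartSymm x z := by
    rw [modelWithCornersSelf_coe, Set.range_id, mfderivWithin_univ]
    rfl
  have h2 : chartField x V z = (dChartSymm x z).inverse (V ((extChartAt 𝓘(ℝ, E) x).symm z)) := by
    rw [← h1]; rfl
  rw [h1] at h
  rw [h2]
  exact h.self_apply_inverse _

theorem chartField_eq [CompleteSpace E] [IsManifold 𝓘(ℝ, E) ∞ M] {x : M} {z : E}
    (hz : z ∈ (extChartAt 𝓘(ℝ, E) x).target) (V : Π y : M, TangentSpace 𝓘(ℝ, E) y) :
    chartField x V z = mfderiv 𝓘(ℝ, E) 𝓘(ℝ, E) (extChartAt 𝓘(ℝ, E) x)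
      ((extChartAt 𝓘(ℝ, E) x).symm z) (V ((extChartAt 𝓘(ℝ, E) x).symm z)) := by
  rw [← dChartSymm_chartField hz V, mfderiv_dChartSymm hz]

theorem differentiableAt_chartField [CompleteSpace E] [IsManifold 𝓘(ℝ, E) ∞ M] {x : M}
    {V : Π y : M, TangentSpace 𝓘(ℝ, E) y}
    (hV : MDifferentiableAt 𝓘(ℝ, E) 𝓘(ℝ, E).tangent (fun y => (V y : TangentBundle 𝓘(ℝ, E) M)) x) :
    DifferentiableAt ℝ (chartField x V) (extChartAt 𝓘(ℝ, E) x x) := by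
  have h := hV.mdifferentiableWithinAt (s := Set.univ)
    |>.differentiableWithinAt_mpullbackWithin_vectorField
  have h1 : DifferentiableWithinAt ℝ (chartField x V) (Set.univ ∩ Set.range (id : E → E))
      (extChartAt 𝓘(ℝ, E) x x) := h
  rwa [Set.range_id, Set.univ_inter, differentiableWithinAt_univ] at h1

theorem mlieBracket_eq_lieBracket_chartField [CompleteSpace E] [IsManifold 𝓘(ℝ, E) ∞ M] (x : M)
    (V W : Π y : M, TangentSpace 𝓘(ℝ, E) y) :
    (mlieBracket 𝓘(ℝ, E) V W x : E) =
      lieBracket ℝ (chartField x V) (chartField x W) (extChartAt 𝓘(ℝ, E) x x) := by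
  have h : mfderiv 𝓘(ℝ, E) 𝓘(ℝ, E) (extChartAt 𝓘(ℝ, E) x) x = ContinuousLinearMap.id ℝ E :=
    ContinuousLinearMap.ext fun v => mfderiv_extChartAt_self x v
  rw [mlieBracket, mlieBracketWithin_apply, h]
  refine (DFunLike.congr_fun (ContinuousLinearMap.inverse_id (R := ℝ) (M := E)) _).trans ?_
  show lieBracketWithin ℝ (chartField x V) (chartField x W) (Set.univ ∩ Set.range (id : E → E))
    (extChartAt 𝓘(ℝ, E) x x) = _
  rw [Set.range_id, Set.univ_inter, lieBracketWithin_univ]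

/-- Lie brackets of related vector fields are related; the case of vector spaces. -/
theorem fderiv_lieBracket {F : E → E'} {z : E} (hF : ContDiffAt ℝ ∞ F z) {V W : E → E}
    {V' W' : E' → E'} (hV : DifferentiableAt ℝ V z) (hW : DifferentiableAt ℝ W z)
    (hV' : DifferentiableAt ℝ V' (F z)) (hW' : DifferentiableAt ℝ W' (F z))
    (hVV' : ∀ᶠ y in 𝓝 z, fderiv ℝ F y (V y) = V' (F y))
    (hWW' : ∀ᶠ y in 𝓝 z, fderiv ℝ F y (W y) = W' (F y)) :
    fderiv ℝ F z (lieBracket ℝ V W z) = lieBracket ℝ V' W' (F z) := by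
  have hF1 : DifferentiableAt ℝ F z := hF.differentiableAt (by simp)
  have hF2 : DifferentiableAt ℝ (fderiv ℝ F) z :=
    (hF.fderiv_right (m := 1) (by norm_cast)).differentiableAt (by simp)
  have hs : IsSymmSndFDerivAt ℝ F z :=
    hF.isSymmSndFDerivAt (by simp only [minSmoothness_of_isRCLikeNormedField]; norm_cast)
  have key : ∀ {V : E → E} {V' : E' → E'}, DifferentiableAt ℝ V z → DifferentiableAt ℝ V' (F z) →
      (∀ᶠ y in 𝓝 z, fderiv ℝ F y (V y) = V' (F y)) → ∀ u,
      fderiv ℝ (fderiv ℝ F) z u (V z) + fderiv ℝ F z (fderiv ℝ V z u) =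
        fderiv ℝ V' (F z) (fderiv ℝ F z u) := by
    intro V V' hV hV' h u
    have h1 : fderiv ℝ (fun y => fderiv ℝ F y (V y)) z u = fderiv ℝ (V' ∘ F) z u :=
      DFunLike.congr_fun (EventuallyEq.fderiv_eq h) u
    rw [fderiv_clm_apply hF2 hV, fderiv_comp z hV' hF1] at h1
    simpa [add_comm] using h1
  have h1 := key hV hV' hVV' (W z)
  have h2 := key hW hW' hWW' (V z)
  rw [lieBracket, lieBracket, map_sub, ← hVV'.self_of_nhds, ← hWW'.self_of_nhds, ← h1, ← h2,
    hs.eq (V z) (W z)]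
  abel

/-- Lie brackets of related vector fields on manifolds are related. -/
theorem mfderiv_mlieBracket [CompleteSpace E] [CompleteSpace E'] [IsManifold 𝓘(ℝ, E) ∞ M]
    [IsManifold 𝓘(ℝ, E') ∞ N] {f : M → N} {x : M} (hf : ContMDiff 𝓘(ℝ, E) 𝓘(ℝ, E') ∞ f)
    {V W : Π y : M, TangentSpace 𝓘(ℝ, E) y} {V' W' : Π y : N, TangentSpace 𝓘(ℝ, E') y}
    (hV : MDifferentiableAt 𝓘(ℝ, E) 𝓘(ℝ, E).tangent (fun y => (V y : TangentBundle 𝓘(ℝ, E) M)) x)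
    (hW : MDifferentiableAt 𝓘(ℝ, E) 𝓘(ℝ, E).tangent (fun y => (W y : TangentBundle 𝓘(ℝ, E) M)) x)
    (hV' : MDifferentiableAt 𝓘(ℝ, E') 𝓘(ℝ, E').tangent
      (fun y => (V' y : TangentBundle 𝓘(ℝ, E') N)) (f x))
    (hW' : MDifferentiableAt 𝓘(ℝ, E') 𝓘(ℝ, E').tangent
      (fun y => (W' y : TangentBundle 𝓘(ℝ, E') N)) (f x))
    (hVV' : ∀ y, mfderiv 𝓘(ℝ, E) 𝓘(ℝ, E') f y (V y) = V' (f y))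
    (hWW' : ∀ y, mfderiv 𝓘(ℝ, E) 𝓘(ℝ, E') f y (W y) = W' (f y)) :
    mfderiv 𝓘(ℝ, E) 𝓘(ℝ, E') f x (mlieBracket 𝓘(ℝ, E) V W x) =
      mlieBracket 𝓘(ℝ, E') V' W' (f x) := by
  let φ := extChartAt 𝓘(ℝ, E) x
  let ψ := extChartAt 𝓘(ℝ, E') (f x)
  let F : E → E' := ψ ∘ f ∘ φ.symm
  have hφx : φ.symm (φ x) = x := extChartAt_to_inv x
  have hFφ : F (φ x) = ψ (f x) := by simp only [F, Function.comp_apply, hφx]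
  have hF : ContDiffAt ℝ ∞ F (φ x) := by
    have h1 : ContDiffWithinAt ℝ ∞ F (Set.range (id : E → E)) (φ x) :=
      (contMDiffAt_iff.1 (hf.contMDiffAt (x := x))).2
    rwa [Set.range_id, contDiffWithinAt_univ] at h1
  have hmf : ∀ u, (mfderiv 𝓘(ℝ, E) 𝓘(ℝ, E') f x u : E') = fderiv ℝ F (φ x) u :=
    fun u => mfderiv_apply_eq_fderiv (hf.mdifferentiableAt (by simp)) u
  have hsrc : ∀ᶠ z in 𝓝 (φ x), z ∈ φ.target ∧ f (φ.symm z) ∈ ψ.source := by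
    refine Filter.Eventually.and (extChartAt_target_mem_nhds (I := 𝓘(ℝ, E)) x) ?_
    have hc : ContinuousAt (fun z => f (φ.symm z)) (φ x) :=
      ContinuousAt.comp (by rw [hφx]; exact hf.continuous.continuousAt)
        (continuousAt_extChartAt_symm x)
    refine hc.preimage_mem_nhds ?_
    rw [hφx]
    exact extChartAt_source_mem_nhds (f x)
  have hrel : ∀ {V : Π y : M, TangentSpace 𝓘(ℝ, E) y} {V' : Π y : N, TangentSpace 𝓘(ℝ, E') y},
      (∀ y, mfderiv 𝓘(ℝ, E) 𝓘(ℝ, E') f y (V y) = V' (f y)) →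
      ∀ᶠ z in 𝓝 (φ x), fderiv ℝ F z (chartField x V z) = chartField (f x) V' (F z) := by
    intro V V' h
    filter_upwards [hsrc] with z hz
    have h1 := mdifferentiableAt_extChartAt_symm hz.1
    have h2 : MDifferentiableAt 𝓘(ℝ, E) 𝓘(ℝ, E') f (φ.symm z) := hf.mdifferentiableAt (by simp)
    have h3 : MDifferentiableAt 𝓘(ℝ, E') 𝓘(ℝ, E') ψ (f (φ.symm z)) :=
      mdifferentiableAt_extChartAt (by simpa [ψ] using hz.2)
    have h4 : fderiv ℝ F z = (mfderiv 𝓘(ℝ, E') 𝓘(ℝ, E') ψ (f (φ.symm z))).comp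
        ((mfderiv 𝓘(ℝ, E) 𝓘(ℝ, E') f (φ.symm z)).comp (dChartSymm x z)) := by
      rw [← mfderiv_eq_fderiv, mfderiv_comp z h3 (h2.comp z h1), mfderiv_comp z h2 h1]
      rfl
    have h5 : ψ.symm (F z) = f (φ.symm z) := ψ.left_inv hz.2
    have h6 : dChartSymm x z (chartField x V z) = V (φ.symm z) := dChartSymm_chartField hz.1 V
    have h7 : ∀ y, y = f (φ.symm z) → (mfderiv 𝓘(ℝ, E') 𝓘(ℝ, E') ψ y (V' y) : E') =
        mfderiv 𝓘(ℝ, E') 𝓘(ℝ, E') ψ (f (φ.symm z)) (V' (f (φ.symm z))) := by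
      rintro _ rfl
      rfl
    refine (DFunLike.congr_fun h4 _).trans (Eq.trans ?_
      (chartField_eq (ψ.map_source hz.2 : F z ∈ ψ.target) V').symm)
    refine Eq.trans ?_ (h7 _ h5).symm
    rw [← h, ← h6]
    rfl
  have hVc := differentiableAt_chartField hV
  have hWc := differentiableAt_chartField hW
  have hVc' := differentiableAt_chartField hV'
  have hWc' := differentiableAt_chartField hW'
  have h := fderiv_lieBracket hF hVc hWc (by rw [hFφ]; exact hVc') (by rw [hFφ]; exact hWc')
    (hrel hVV') (hrel hWW')
  rw [hFφ] at h
  exact (hmf _).trans ((congrArg _ (mlieBracket_eq_lieBracket_chartField x V W)).trans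
    (h.trans (mlieBracket_eq_lieBracket_chartField (f x) V' W').symm))

end Brackets

/-! ### The Maurer-Cartan equation -/

section LieGroups

open Topology Filter VectorField

variable {E : Type*} [NormedAddCommGroup E] [NormedSpace ℝ E]
  {G : Type*} [TopologicalSpace G] [ChartedSpace E G] [Group G]

/-- Tangent spaces at equal points are identified through the model space. -/
theorem mfderiv_congr_of_eq {E' : Type*} [NormedAddCommGroup E'] [NormedSpace ℝ E']
    {M N : Type*} [TopologicalSpace M] [ChartedSpace E M] [TopologicalSpace N] [ChartedSpace E' N]
    (f : M → N) {x y : M} (h : x = y) (u : E) :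
    (mfderiv 𝓘(ℝ, E) 𝓘(ℝ, E') f x u : E') = mfderiv 𝓘(ℝ, E) 𝓘(ℝ, E') f y u := by
  subst h; rfl

theorem mfderiv_one_mul (h : G) (v : E) :
    (mfderiv 𝓘(ℝ, E) 𝓘(ℝ, E) (fun x : G => 1 * x) h v : E) = v := by
  have h1 : (fun x : G => 1 * x) = id := by funext x; simp
  have h2 : mfderiv 𝓘(ℝ, E) 𝓘(ℝ, E) (id : G → G) h v = v := by rw [mfderiv_id]; rfl
  rw [h1]
  exact h2

/-- The Maurer-Cartan form at `g` as a linear map. -/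
def mcLin (g : G) : TangentSpace 𝓘(ℝ, E) g →ₗ[ℝ] GroupLieAlgebra 𝓘(ℝ, E) G :=
  (mfderiv 𝓘(ℝ, E) 𝓘(ℝ, E) (fun h : G => g⁻¹ * h) g).toLinearMap

theorem mcLin_apply (g : G) (v : TangentSpace 𝓘(ℝ, E) g) : mcLin g v = maurerCartan g v := rfl

variable [LieGroup 𝓘(ℝ, E) ∞ G]

/-- The smoothness that Mathlib requires for the Lie algebra of a Lie group. -/
instance instLieGroupMinSmoothness : LieGroup 𝓘(ℝ, E) (minSmoothness ℝ 3) G := by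
  rw [minSmoothness_of_isRCLikeNormedField]; infer_instance

theorem mdifferentiableAt_mul_left' (a h : G) :
    MDifferentiableAt 𝓘(ℝ, E) 𝓘(ℝ, E) (fun x : G => a * x) h :=
  (contMDiff_mul_left (n := ∞)).mdifferentiableAt (by simp)

theorem mfderiv_mul_left_mul_left {a b h k : G} (hk : b * h = k) (v : E) :
    (mfderiv 𝓘(ℝ, E) 𝓘(ℝ, E) (fun x : G => a * x) k
      (mfderiv 𝓘(ℝ, E) 𝓘(ℝ, E) (fun x : G => b * x) h v : E) : E) =
    mfderiv 𝓘(ℝ, E) 𝓘(ℝ, E) (fun x : G => (a * b) * x) h v := by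
  subst hk
  have h1 : (fun x : G => (a * b) * x) = (fun x : G => a * x) ∘ (fun x : G => b * x) := by
    funext x; simp [mul_assoc]
  rw [h1]
  exact (mfderiv_comp_apply h (mdifferentiableAt_mul_left' a (b * h))
    (mdifferentiableAt_mul_left' b h) v).symm

theorem maurerCartan_mulInvariantVectorField (v : GroupLieAlgebra 𝓘(ℝ, E) G) (g : G) :
    maurerCartan g (mulInvariantVectorField v g) = v := by
  refine (mfderiv_mul_left_mul_left (E := E) (mul_one g) v).trans ?_
  rw [inv_mul_cancel]
  exact mfderiv_one_mul (E := E) 1 v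

theorem mulInvariantVectorField_maurerCartan (g : G) (v : TangentSpace 𝓘(ℝ, E) g) :
    mulInvariantVectorField (maurerCartan g v) g = v := by
  refine (mfderiv_mul_left_mul_left (E := E) (inv_mul_cancel g) v).trans ?_
  rw [mul_inv_cancel]
  exact mfderiv_one_mul (E := E) g v

omit [LieGroup 𝓘(ℝ, E) ∞ G] in
theorem maurerCartan_one (v : GroupLieAlgebra 𝓘(ℝ, E) G) : maurerCartan (1 : G) v = v := by
  have h : (fun x : G => (1 : G)⁻¹ * x) = fun x => 1 * x := by simp
  unfold maurerCartan
  rw [h]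
  exact mfderiv_one_mul (E := E) 1 v

section Hom

variable {E' : Type*} [NormedAddCommGroup E'] [NormedSpace ℝ E']
  {H : Type*} [TopologicalSpace H] [ChartedSpace E' H] [Group H] [LieGroup 𝓘(ℝ, E') ∞ H]

/-- The differential at the identity of a map between Lie groups that preserves the identity. -/
def lieMap (f : G → H) : GroupLieAlgebra 𝓘(ℝ, E) G →ₗ[ℝ] GroupLieAlgebra 𝓘(ℝ, E') H :=
  (mfderiv 𝓘(ℝ, E) 𝓘(ℝ, E') f 1 : E →L[ℝ] E').toLinearMap

theorem mfderiv_mulInvariantVectorField (f : G →* H) (hf : ContMDiff 𝓘(ℝ, E) 𝓘(ℝ, E') ∞ f)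
    (v : GroupLieAlgebra 𝓘(ℝ, E) G) (g : G) :
    mfderiv 𝓘(ℝ, E) 𝓘(ℝ, E') f g (mulInvariantVectorField v g) =
      mulInvariantVectorField (lieMap f v) (f g) := by
  have h1 : (f ∘ fun x => g * x) = (fun x => f g * x) ∘ f := by funext x; simp
  have hfd : ∀ x, MDifferentiableAt 𝓘(ℝ, E) 𝓘(ℝ, E') f x := fun x =>
    hf.mdifferentiableAt (by simp)
  have h2 := mfderiv_comp_apply 1 (hfd (g * 1)) (mdifferentiableAt_mul_left' g 1) v
  have h3 := mfderiv_comp_apply 1 (mdifferentiableAt_mul_left' (f g) (f 1)) (hfd 1) v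
  refine (mfderiv_congr_of_eq f (mul_one g).symm _).trans (h2.symm.trans ?_)
  refine Eq.trans ?_ (h3.trans (mfderiv_congr_of_eq _ (map_one f) _))
  rw [h1]

/-- The differential of a homomorphism of Lie groups is a homomorphism of Lie algebras. -/
theorem lieMap_lie [CompleteSpace E] [CompleteSpace E'] (f : G →* H)
    (hf : ContMDiff 𝓘(ℝ, E) 𝓘(ℝ, E') ∞ f) (v w : GroupLieAlgebra 𝓘(ℝ, E) G) :
    (lieMap f ⁅v, w⁆ : GroupLieAlgebra 𝓘(ℝ, E') H) =
      ⁅(lieMap f v : GroupLieAlgebra 𝓘(ℝ, E') H), (lieMap f w : GroupLieAlgebra 𝓘(ℝ, E') H)⁆ := by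
  have h := mfderiv_mlieBracket (x := 1) hf (mdifferentiableAt_mulInvariantVectorField v)
    (mdifferentiableAt_mulInvariantVectorField w)
    (mdifferentiableAt_mulInvariantVectorField (lieMap f v))
    (mdifferentiableAt_mulInvariantVectorField (lieMap f w))
    (mfderiv_mulInvariantVectorField f hf v) (mfderiv_mulInvariantVectorField f hf w)
  rw [GroupLieAlgebra.bracket_def, GroupLieAlgebra.bracket_def]
  refine Eq.trans h ?_
  rw [map_one]

end Hom

/-- The Maurer-Cartan form in the preferred chart at `x`, at the point `z`, as the derivative of
`y ↦ z⁻¹ y` written in charts at `x` and at the identity; in this form its smoothness in `z` is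
clear. -/
def mcChart (x : G) (z : E) : E →L[ℝ] E :=
  fderiv ℝ (fun y => extChartAt 𝓘(ℝ, E) (1 : G)
    (((extChartAt 𝓘(ℝ, E) x).symm z)⁻¹ * (extChartAt 𝓘(ℝ, E) x).symm y)) z

theorem contMDiffAt_extChartAt_symm {M : Type*} [TopologicalSpace M] [ChartedSpace E M]
    [IsManifold 𝓘(ℝ, E) ∞ M] {x : M} {z : E} (hz : z ∈ (extChartAt 𝓘(ℝ, E) x).target) :
    ContMDiffAt 𝓘(ℝ, E) 𝓘(ℝ, E) ∞ (extChartAt 𝓘(ℝ, E) x).symm z :=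
  (contMDiffOn_extChartAt_symm x).contMDiffAt ((isOpen_extChartAt_target x).mem_nhds hz)

/-- The inverse of a chart in either one of two variables is smooth. -/
theorem contMDiffAt_fst_snd_symm {x : G} {p : E × E}
    (h1 : p.1 ∈ (extChartAt 𝓘(ℝ, E) x).target) (h2 : p.2 ∈ (extChartAt 𝓘(ℝ, E) x).target) :
    ContMDiffAt 𝓘(ℝ, E × E) 𝓘(ℝ, E) ∞ (fun q : E × E => (extChartAt 𝓘(ℝ, E) x).symm q.1) p ∧
    ContMDiffAt 𝓘(ℝ, E × E) 𝓘(ℝ, E) ∞ (fun q : E × E => (extChartAt 𝓘(ℝ, E) x).symm q.2) p :=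
  ⟨ContMDiffAt.comp p (contMDiffAt_extChartAt_symm h1) contDiffAt_fst.contMDiffAt,
    ContMDiffAt.comp p (contMDiffAt_extChartAt_symm h2) contDiffAt_snd.contMDiffAt⟩

theorem contDiffAt_mcChart {x : G} {z : E} (hz : z ∈ (extChartAt 𝓘(ℝ, E) x).target) :
    ContDiffAt ℝ ∞ (mcChart x) z := by
  have h := contMDiffAt_fst_snd_symm (p := (z, z)) hz hz
  have h1 : ContMDiffAt 𝓘(ℝ, E × E) 𝓘(ℝ, E) ∞ (fun q : E × E =>
      extChartAt 𝓘(ℝ, E) (1 : G)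
        (((extChartAt 𝓘(ℝ, E) x).symm q.1)⁻¹ * (extChartAt 𝓘(ℝ, E) x).symm q.2)) (z, z) := by
    refine ContMDiffAt.comp (z, z) (contMDiffAt_extChartAt' ?_) (h.1.inv.mul h.2)
    simp
  exact ContDiffAt.fderiv (n := ∞) (m := ∞) (g := id) h1.contDiffAt contDiffAt_id (by simp)

theorem maurerCartan_dChartSymm {x : G} {z : E} (hz : z ∈ (extChartAt 𝓘(ℝ, E) x).target) (u : E) :
    (maurerCartan ((extChartAt 𝓘(ℝ, E) x).symm z) (dChartSymm x z u) : E) = mcChart x z u := by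
  set a := (extChartAt 𝓘(ℝ, E) x).symm z with ha
  have h1 := mdifferentiableAt_extChartAt_symm hz
  have h2 := mdifferentiableAt_mul_left' (E := E) a⁻¹ a
  have h3 : MDifferentiableAt 𝓘(ℝ, E) 𝓘(ℝ, E) (extChartAt 𝓘(ℝ, E) (1 : G)) (a⁻¹ * a) :=
    mdifferentiableAt_extChartAt (by simp)
  have h4 := mfderiv_comp_apply z h3 (h2.comp z h1) u
  have h5 := mfderiv_comp_apply z h2 h1 u
  have h6 : (mfderiv 𝓘(ℝ, E) 𝓘(ℝ, E) ((extChartAt 𝓘(ℝ, E) (1 : G)) ∘ (fun x : G => a⁻¹ * x) ∘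
      (extChartAt 𝓘(ℝ, E) x).symm) z u : E) = mcChart x z u := by
    rw [mfderiv_eq_fderiv]; rfl
  refine Eq.trans ?_ (h4.symm.trans h6)
  refine Eq.trans ?_ (mfderiv_congr_of_eq _ (inv_mul_cancel a) _).symm
  refine Eq.trans ?_ (mfderiv_extChartAt_self (1 : G) _).symm
  exact h5.symm

/-- The Maurer-Cartan equation `dω + ½[ω, ω] = 0`, followed by a linear map. -/
theorem extDerivOneForm_maurerCartan [CompleteSpace E] {W : Type*} [NormedAddCommGroup W]
    [NormedSpace ℝ W] (P : E →L[ℝ] W) (g : G) (v w : TangentSpace 𝓘(ℝ, E) g) :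
    extDerivOneForm (fun (h : G) (u : TangentSpace 𝓘(ℝ, E) h) => P (maurerCartan h u)) g v w =
      -P (⁅maurerCartan g v, maurerCartan g w⁆ : GroupLieAlgebra 𝓘(ℝ, E) G) := by
  set z := extChartAt 𝓘(ℝ, E) g g with hzdef
  have hz : z ∈ (extChartAt 𝓘(ℝ, E) g).target := mem_extChartAt_target g
  have htgt : ∀ᶠ y in 𝓝 z, y ∈ (extChartAt 𝓘(ℝ, E) g).target :=
    extChartAt_target_mem_nhds (I := 𝓘(ℝ, E)) g
  have hA : DifferentiableAt ℝ (mcChart g) z := (contDiffAt_mcChart hz).differentiableAt (by simp)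
  -- the form in the chart
  have h1 : ∀ a u : E, fderiv ℝ (fun y => P (maurerCartan ((extChartAt 𝓘(ℝ, E) g).symm y)
      (dChartSymm g y u))) z a = P (fderiv ℝ (mcChart g) z a u) := by
    intro a u
    have h2 : (fun y => P (maurerCartan ((extChartAt 𝓘(ℝ, E) g).symm y) (dChartSymm g y u)))
        =ᶠ[𝓝 z] fun y => P (mcChart g y u) := by
      filter_upwards [htgt] with y hy
      exact congrArg P (maurerCartan_dChartSymm hy u)
    rw [h2.fderiv_eq]
    have h3 := (P.hasFDerivAt (x := mcChart g z u)).comp z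
      (hA.hasFDerivAt.clm_apply (hasFDerivAt_const u z))
    have h4 := DFunLike.congr_fun h3.fderiv a
    refine Eq.trans h4 ?_
    simp
  have hval : ∀ v : TangentSpace 𝓘(ℝ, E) g,
      chartField g (mulInvariantVectorField (maurerCartan g v)) z = v := by
    intro v
    have h6 : ∀ y, y = g → (mulInvariantVectorField (maurerCartan g v) y : E) = v := by
      rintro _ rfl
      exact mulInvariantVectorField_maurerCartan _ v
    refine (dChartSymm_self g _).symm.trans ?_
    exact Eq.trans (dChartSymm_chartField hz _) (h6 _ (extChartAt_to_inv g))
  -- the form is constant on left-invariant fields; differentiate this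
  have key : ∀ (v : TangentSpace 𝓘(ℝ, E) g) (a : E), fderiv ℝ (mcChart g) z a v =
      -mcChart g z (fderiv ℝ (chartField g (mulInvariantVectorField (maurerCartan g v))) z a) := by
    intro v a
    let c : E := maurerCartan g v
    have hV := differentiableAt_chartField
      (mdifferentiableAt_mulInvariantVectorField (I := 𝓘(ℝ, E)) (maurerCartan g v) (g := g))
    have h2 : (fun y => mcChart g y (chartField g (mulInvariantVectorField (maurerCartan g v)) y))
        =ᶠ[𝓝 z] fun _ => c := by
      filter_upwards [htgt] with y hy
      rw [← maurerCartan_dChartSymm hy, dChartSymm_chartField hy]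
      exact maurerCartan_mulInvariantVectorField _ _
    have h3 := h2.fderiv_eq (𝕜 := ℝ)
    rw [fderiv_clm_apply hA hV] at h3
    have h4 := DFunLike.congr_fun h3 a
    rw [hval] at h4
    have h7 : mcChart g z (fderiv ℝ (chartField g (mulInvariantVectorField (maurerCartan g v))) z a)
        + fderiv ℝ (mcChart g) z a v = 0 := by
      exact h4.trans (by rw [fderiv_fun_const]; rfl)
    exact eq_neg_of_add_eq_zero_right h7
  have hv' : ∀ v : TangentSpace 𝓘(ℝ, E) g,
      (mfderiv 𝓘(ℝ, E) 𝓘(ℝ, E) (extChartAt 𝓘(ℝ, E) g) g v : E) = v :=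
    fun v => mfderiv_extChartAt_self g v
  have hbr : mcChart g z (lieBracket ℝ (chartField g (mulInvariantVectorField (maurerCartan g v)))
      (chartField g (mulInvariantVectorField (maurerCartan g w))) z) =
      (⁅maurerCartan g v, maurerCartan g w⁆ : GroupLieAlgebra 𝓘(ℝ, E) G) := by
    rw [← mlieBracket_eq_lieBracket_chartField g, ← mulInvariantVector_mlieBracket,
      ← GroupLieAlgebra.bracket_def]
    refine (maurerCartan_dChartSymm hz _).symm.trans ?_
    have h8 : ∀ (y : G) (a b : E), y = g → a = b →
        (maurerCartan y a : E) = maurerCartan g b := by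
      rintro _ _ _ rfl rfl
      rfl
    refine (h8 _ _ _ (extChartAt_to_inv g) (dChartSymm_self g _)).trans ?_
    exact maurerCartan_mulInvariantVectorField _ _
  show fderiv ℝ (fun y => P (maurerCartan ((extChartAt 𝓘(ℝ, E) g).symm y) (dChartSymm g y
      (mfderiv 𝓘(ℝ, E) 𝓘(ℝ, E) (extChartAt 𝓘(ℝ, E) g) g w : E)))) z
      (mfderiv 𝓘(ℝ, E) 𝓘(ℝ, E) (extChartAt 𝓘(ℝ, E) g) g v : E) -
    fderiv ℝ (fun y => P (maurerCartan ((extChartAt 𝓘(ℝ, E) g).symm y) (dChartSymm g y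
      (mfderiv 𝓘(ℝ, E) 𝓘(ℝ, E) (extChartAt 𝓘(ℝ, E) g) g v : E)))) z
      (mfderiv 𝓘(ℝ, E) 𝓘(ℝ, E) (extChartAt 𝓘(ℝ, E) g) g w : E) = _
  rw [hv' v, hv' w]
  refine (congrArg₂ (· - ·) (h1 _ _) (h1 _ _)).trans ?_
  refine (congrArg₂ (fun a b => P a - P b) (key w v) (key v w)).trans ?_
  refine Eq.trans ?_ (congrArg (fun a => -P a) hbr)
  rw [lieBracket, hval v, hval w]
  simp only [map_sub, map_neg]
  abel

end LieGroups

/-! ### The adjoint representation -/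

section Adjoint

open Topology Filter VectorField

/-- The mixed second derivatives of a function of two variables agree. -/
theorem fderiv_fderiv_swap {E F : Type*} [NormedAddCommGroup E] [NormedSpace ℝ E]
    [NormedAddCommGroup F] [NormedSpace ℝ F] {n : E × E → F} {e : E}
    (hn : ContDiffAt ℝ ∞ n (e, e)) (v u : E) :
    fderiv ℝ (fun z => fderiv ℝ (fun y => n (z, y)) e) e v u =
      fderiv ℝ (fun z => fderiv ℝ (fun y => n (y, z)) e) e u v := by
  have h2 : DifferentiableAt ℝ (fderiv ℝ n) (e, e) :=
    (hn.fderiv_right (m := 1) (by norm_cast)).differentiableAt (by simp)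
  have hs : IsSymmSndFDerivAt ℝ n (e, e) :=
    hn.isSymmSndFDerivAt (by simp only [minSmoothness_of_isRCLikeNormedField]; norm_cast)
  have hev : ∀ᶠ p in 𝓝 (e, e), DifferentiableAt ℝ n p := by
    have h1 : ContDiffAt ℝ 1 n (e, e) := hn.of_le (by norm_cast)
    filter_upwards [h1.eventually (by simp)] with p hp using hp.differentiableAt (by simp)
  have hl : ∀ z : E, HasFDerivAt (fun y : E => (z, y)) (ContinuousLinearMap.inr ℝ E E) e :=
    fun z => hasFDerivAt_prodMk_right z e
  have hr : ∀ z : E, HasFDerivAt (fun y : E => (y, z)) (ContinuousLinearMap.inl ℝ E E) e :=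
    fun z => hasFDerivAt_prodMk_left e z
  have h3 : (fun z => fderiv ℝ (fun y => n (z, y)) e) =ᶠ[𝓝 e]
      fun z => (fderiv ℝ n (z, e)).comp (ContinuousLinearMap.inr ℝ E E) := by
    have hc : ContinuousAt (fun z : E => (z, e)) e := by fun_prop
    filter_upwards [hc.eventually hev] with z hz
    exact (hz.hasFDerivAt.comp e (hl z)).fderiv
  have h4 : (fun z => fderiv ℝ (fun y => n (y, z)) e) =ᶠ[𝓝 e]
      fun z => (fderiv ℝ n (e, z)).comp (ContinuousLinearMap.inl ℝ E E) := by
    have hc : ContinuousAt (fun z : E => (e, z)) e := by fun_prop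
    filter_upwards [hc.eventually hev] with z hz
    exact (hz.hasFDerivAt.comp e (hr z)).fderiv
  have h5 := (HasFDerivAt.comp (g := fderiv ℝ n) (f := fun z => (z, e)) e h2.hasFDerivAt
    (hr e)).clm_comp (hasFDerivAt_const (ContinuousLinearMap.inr ℝ E E) e)
  have h6 := (HasFDerivAt.comp (g := fderiv ℝ n) (f := fun z => (e, z)) e h2.hasFDerivAt
    (hl e)).clm_comp (hasFDerivAt_const (ContinuousLinearMap.inl ℝ E E) e)
  rw [h3.fderiv_eq, h4.fderiv_eq]
  refine (congrArg (fun L => L v u) h5.fderiv).trans (Eq.trans ?_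
    (congrArg (fun L => L u v) h6.fderiv).symm)
  simpa using hs.eq (v, 0) (0, u)

variable {E : Type*} [NormedAddCommGroup E] [NormedSpace ℝ E]
  {G : Type*} [TopologicalSpace G] [ChartedSpace E G] [Group G] [LieGroup 𝓘(ℝ, E) ∞ G]

theorem contMDiff_conj (g : G) : ContMDiff 𝓘(ℝ, E) 𝓘(ℝ, E) ∞ (MulAut.conj g : G → G) := by
  have h : ContMDiff 𝓘(ℝ, E) 𝓘(ℝ, E) ∞ fun x : G => g * x * g⁻¹ :=
    (contMDiff_const.mul contMDiff_id).mul contMDiff_const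
  exact h

/-- The adjoint representation: the differential at the identity of conjugation by `g`. -/
def Ad (g : G) : GroupLieAlgebra 𝓘(ℝ, E) G →ₗ[ℝ] GroupLieAlgebra 𝓘(ℝ, E) G :=
  lieMap (MulAut.conj g : G → G)

omit [LieGroup 𝓘(ℝ, E) ∞ G] in
theorem lieMap_comp {E' E'' : Type*} [NormedAddCommGroup E'] [NormedSpace ℝ E']
    [NormedAddCommGroup E''] [NormedSpace ℝ E''] {H H' : Type*} [TopologicalSpace H]
    [ChartedSpace E' H] [Group H] [TopologicalSpace H'] [ChartedSpace E'' H'] [Group H']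
    {f : G → H} {f' : H → H'} (hf : MDifferentiableAt 𝓘(ℝ, E) 𝓘(ℝ, E') f 1) (hf1 : f 1 = 1)
    (hf' : MDifferentiableAt 𝓘(ℝ, E') 𝓘(ℝ, E'') f' 1) (v : GroupLieAlgebra 𝓘(ℝ, E) G) :
    (lieMap (f' ∘ f) v : GroupLieAlgebra 𝓘(ℝ, E'') H') =
      lieMap f' (lieMap f v : GroupLieAlgebra 𝓘(ℝ, E') H) := by
  rw [← hf1] at hf'
  exact (mfderiv_comp_apply 1 hf' hf v).trans (mfderiv_congr_of_eq f' hf1 _)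

theorem mdifferentiableAt_conj (g h : G) :
    MDifferentiableAt 𝓘(ℝ, E) 𝓘(ℝ, E) (MulAut.conj g : G → G) h :=
  (contMDiff_conj g).mdifferentiableAt (by simp)

theorem Ad_mul (g h : G) (v : GroupLieAlgebra 𝓘(ℝ, E) G) : Ad (g * h) v = Ad g (Ad h v) := by
  have h1 : (MulAut.conj (g * h) : G → G) = (MulAut.conj g : G → G) ∘ (MulAut.conj h : G → G) := by
    funext x; simp
  rw [Ad, h1]
  exact lieMap_comp (mdifferentiableAt_conj h 1) (map_one _) (mdifferentiableAt_conj g 1) v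

omit [LieGroup 𝓘(ℝ, E) ∞ G] in
theorem Ad_one (v : GroupLieAlgebra 𝓘(ℝ, E) G) : Ad (1 : G) v = v := by
  have h1 : (MulAut.conj (1 : G) : G → G) = id := by funext x; simp
  have h2 : mfderiv 𝓘(ℝ, E) 𝓘(ℝ, E) (id : G → G) 1 v = v := by rw [mfderiv_id]; rfl
  rw [Ad, h1]
  exact h2

theorem Ad_lie [CompleteSpace E] (g : G) (v w : GroupLieAlgebra 𝓘(ℝ, E) G) :
    Ad g ⁅v, w⁆ = ⁅Ad g v, Ad g w⁆ :=
  lieMap_lie (MulAut.conj g).toMonoidHom (contMDiff_conj g) v w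

/-- Right translation acts on the Maurer-Cartan form through the adjoint representation. -/
theorem maurerCartan_mul_right (g k : G) (v : TangentSpace 𝓘(ℝ, E) g) :
    maurerCartan (g * k) (mfderiv 𝓘(ℝ, E) 𝓘(ℝ, E) (fun x : G => x * k) g v) =
      Ad k⁻¹ (maurerCartan g v) := by
  have hr : MDifferentiableAt 𝓘(ℝ, E) 𝓘(ℝ, E) (fun x : G => x * k) g :=
    (contMDiff_mul_right (n := ∞)).mdifferentiableAt (by simp)
  have h1 : (fun x : G => (g * k)⁻¹ * x) ∘ (fun x : G => x * k) =
      (MulAut.conj k⁻¹ : G → G) ∘ (fun x : G => g⁻¹ * x) := by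
    funext x; simp [mul_assoc]
  have h2 := mfderiv_comp_apply g (mdifferentiableAt_mul_left' (g * k)⁻¹ (g * k)) hr v
  have h3 := mfderiv_comp_apply g (mdifferentiableAt_conj k⁻¹ (g⁻¹ * g))
    (mdifferentiableAt_mul_left' g⁻¹ g) v
  rw [← h1] at h3
  exact h2.symm.trans (h3.trans (mfderiv_congr_of_eq _ (inv_mul_cancel g) _))

/-- The orbit map `g ↦ Ad g u`, as a map to the model space of `G`, which unlike the Lie algebra
carries a norm. -/
def AdOrbit (u : GroupLieAlgebra 𝓘(ℝ, E) G) : G → E := fun g => Ad g u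

/-- The derivative of the adjoint representation at the identity is the Lie bracket. In a chart
the identity `g x = (g x g⁻¹) g` writes the left-invariant fields as `Ad g` followed by the
right-invariant ones; the mixed second derivatives of the multiplication are symmetric, so the
antisymmetrization that defines the bracket leaves only the derivative of `Ad`. -/
theorem hasMFDerivAt_AdOrbit [CompleteSpace E] (u : GroupLieAlgebra 𝓘(ℝ, E) G) :
    ∃ L : E →L[ℝ] E, HasMFDerivAt 𝓘(ℝ, E) 𝓘(ℝ, E) (AdOrbit u) (1 : G) L ∧
      ∀ v : GroupLieAlgebra 𝓘(ℝ, E) G, (L v : E) = ⁅v, u⁆ := by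
  let φ := extChartAt 𝓘(ℝ, E) (1 : G)
  let e : E := φ 1
  have he : φ.symm e = 1 := extChartAt_to_inv 1
  have het : e ∈ φ.target := mem_extChartAt_target 1
  have htgt : ∀ᶠ z in 𝓝 e, z ∈ φ.target := extChartAt_target_mem_nhds (I := 𝓘(ℝ, E)) (1 : G)
  have hφ : ∀ x ∈ φ.source, ContMDiffAt 𝓘(ℝ, E) 𝓘(ℝ, E) ∞ φ x := fun x hx =>
    contMDiffAt_extChartAt' (by simpa [φ] using hx)
  -- multiplication and conjugation in the chart
  let n : E × E → E := fun p => φ (φ.symm p.1 * φ.symm p.2)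
  let q : E × E → E := fun p => φ (φ.symm p.1 * φ.symm p.2 * (φ.symm p.1)⁻¹)
  have hn : ∀ p : E × E, p.1 ∈ φ.target → p.2 ∈ φ.target → φ.symm p.1 * φ.symm p.2 ∈ φ.source →
      ContDiffAt ℝ ∞ n p := by
    intro p h1 h2 h3
    have h := contMDiffAt_fst_snd_symm h1 h2
    exact (ContMDiffAt.comp p (hφ _ h3) (h.1.mul h.2)).contDiffAt
  have hq : ∀ z ∈ φ.target, ContDiffAt ℝ ∞ q (z, e) := by
    intro z hz
    have h := contMDiffAt_fst_snd_symm (p := (z, e)) hz het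
    refine (ContMDiffAt.comp (z, e) (hφ _ ?_) ((h.1.mul h.2).mul h.1.inv)).contDiffAt
    show φ.symm z * φ.symm e * (φ.symm z)⁻¹ ∈ φ.source
    rw [he, mul_one, mul_inv_cancel]
    exact mem_extChartAt_source (1 : G)
  have hne : ContDiffAt ℝ ∞ n (e, e) := hn (e, e) het het (by
    show φ.symm e * φ.symm e ∈ φ.source
    rw [he, mul_one]
    exact mem_extChartAt_source (1 : G))
  -- the differentials at the identity of left translation, right translation and conjugation
  let b : E → E →L[ℝ] E := fun z => fderiv ℝ (fun y => n (z, y)) e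
  let a : E → E →L[ℝ] E := fun z => fderiv ℝ (fun y => n (y, z)) e
  let c : E → E →L[ℝ] E := fun z => fderiv ℝ (fun y => q (z, y)) e
  have ha : DifferentiableAt ℝ a e := by
    have h1 : ContDiffAt ℝ ∞ (Function.uncurry fun z y => n (y, z)) (e, e) :=
      ContDiffAt.comp (f := fun p : E × E => (p.2, p.1)) (e, e) hne (by fun_prop)
    have h2 : ContDiffAt ℝ ∞ a e :=
      ContDiffAt.fderiv (n := ∞) (m := ∞) (g := fun _ => e) h1 contDiffAt_const (by simp)
    exact h2.differentiableAt (by simp)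
  have hc : DifferentiableAt ℝ c e := by
    have h2 : ContDiffAt ℝ ∞ c e :=
      ContDiffAt.fderiv (n := ∞) (m := ∞) (f := fun z y => q (z, y)) (g := fun _ => e) (hq e het)
        contDiffAt_const (by simp)
    exact h2.differentiableAt (by simp)
  have hqe : ∀ z, q (z, e) = e := fun z => by simp [q, he, e]
  have hnz : ∀ z ∈ φ.target, DifferentiableAt ℝ (fun y => n (y, z)) e := by
    intro z hz
    have h1 := (hn (e, z) het hz (by simpa [he] using φ.map_target hz)).differentiableAt (by simp)
    exact DifferentiableAt.comp (g := n) (f := fun y => (y, z)) e h1 (by fun_prop)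
  have hqz : ∀ z ∈ φ.target, DifferentiableAt ℝ (fun y => q (z, y)) e := by
    intro z hz
    have h1 := (hq z hz).differentiableAt (by simp)
    exact DifferentiableAt.comp (g := q) (f := fun y => (z, y)) e h1 (by fun_prop)
  -- `g x = (g x g⁻¹) g`
  have hrel : ∀ z ∈ φ.target, (a z).comp (c z) = b z := by
    intro z hz
    have h1 : (fun y => n (z, y)) =ᶠ[𝓝 e] (fun y => n (y, z)) ∘ fun y => q (z, y) := by
      have : IsTopologicalGroup G := topologicalGroup_of_lieGroup 𝓘(ℝ, E) ∞
      have hcont : ContinuousAt (fun y => φ.symm z * φ.symm y * (φ.symm z)⁻¹) e :=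
        ((continuousAt_const.mul (continuousAt_extChartAt_symm (I := 𝓘(ℝ, E)) (1 : G))).mul
          continuousAt_const)
      have hmem : ∀ᶠ y in 𝓝 e, φ.symm z * φ.symm y * (φ.symm z)⁻¹ ∈ φ.source := by
        refine hcont.preimage_mem_nhds ?_
        have : φ.symm z * φ.symm e * (φ.symm z)⁻¹ = 1 := by simp [he]
        rw [this]
        exact extChartAt_source_mem_nhds (1 : G)
      filter_upwards [hmem] with y hy
      have h2 : φ.symm (q (z, y)) = φ.symm z * φ.symm y * (φ.symm z)⁻¹ := φ.left_inv hy
      simp only [Function.comp_apply, n, h2, inv_mul_cancel_right]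
    have h3 : DifferentiableAt ℝ (fun y => n (y, z)) (q (z, e)) := by rw [hqe]; exact hnz z hz
    have h4 := fderiv_comp e h3 (hqz z hz)
    rw [← h1.fderiv_eq, hqe] at h4
    exact h4.symm
  have hae : ∀ w, a e w = w := by
    intro w
    have h1 : (fun y => n (y, e)) =ᶠ[𝓝 e] id := by
      filter_upwards [htgt] with y hy
      simp only [n, he, mul_one, id]
      exact φ.right_inv hy
    show fderiv ℝ (fun y => n (y, e)) e w = w
    rw [h1.fderiv_eq, fderiv_id]
    rfl
  have hce : ∀ w, c e w = w := by
    intro w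
    have h1 : (fun y => q (e, y)) =ᶠ[𝓝 e] id := by
      filter_upwards [htgt] with y hy
      simp only [q, he, one_mul, inv_one, mul_one, id]
      exact φ.right_inv hy
    show fderiv ℝ (fun y => q (e, y)) e w = w
    rw [h1.fderiv_eq, fderiv_id]
    rfl
  -- left-invariant fields in the chart
  have hb : ∀ w : GroupLieAlgebra 𝓘(ℝ, E) G,
      chartField 1 (mulInvariantVectorField w) =ᶠ[𝓝 e] fun z => b z w := by
    intro w
    filter_upwards [htgt] with z hz
    have h1 := mdifferentiableAt_extChartAt_symm het
    have h2 := mdifferentiableAt_mul_left' (E := E) (φ.symm z) (φ.symm e)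
    have h3 : MDifferentiableAt 𝓘(ℝ, E) 𝓘(ℝ, E) φ (φ.symm z * φ.symm e) :=
      (hφ _ (by simpa [he] using φ.map_target hz)).mdifferentiableAt (by simp)
    have h4 := mfderiv_comp_apply e h3 (h2.comp e h1) w
    have h5 := mfderiv_comp_apply e h2 h1 w
    have h6 : (mfderiv 𝓘(ℝ, E) 𝓘(ℝ, E) (φ ∘ (fun x : G => φ.symm z * x) ∘ φ.symm) e w : E) =
        b z w := by
      rw [mfderiv_eq_fderiv]; rfl
    refine (chartField_eq hz _).trans (Eq.trans ?_ (h4.symm.trans h6))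
    have h7 : φ.symm z * φ.symm e = φ.symm z := by rw [he, mul_one]
    refine Eq.trans ?_ (mfderiv_congr_of_eq φ h7 _).symm
    refine congrArg (mfderiv 𝓘(ℝ, E) 𝓘(ℝ, E) φ (φ.symm z)) ?_
    refine Eq.trans ?_ h5.symm
    refine Eq.trans ?_ (mfderiv_congr_of_eq _ he _).symm
    exact congrArg (mfderiv 𝓘(ℝ, E) 𝓘(ℝ, E) (fun x : G => φ.symm z * x) 1)
      (dChartSymm_self (E := E) (1 : G) w).symm
  have hbr : ∀ v : GroupLieAlgebra 𝓘(ℝ, E) G,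
      (⁅v, u⁆ : GroupLieAlgebra 𝓘(ℝ, E) G) = (fderiv ℝ c e (v : E) (u : E) : E) := by
    intro v
    have hbd : DifferentiableAt ℝ b e := by
      have h2 : ContDiffAt ℝ ∞ b e :=
        ContDiffAt.fderiv (n := ∞) (m := ∞) (f := fun z y => n (z, y)) (g := fun _ => e) hne
          contDiffAt_const (by simp)
      exact h2.differentiableAt (by simp)
    have h1 : ∀ w w' : E, fderiv ℝ (chartField (1 : G)
        (mulInvariantVectorField (I := 𝓘(ℝ, E)) (G := G) w)) e w' = fderiv ℝ b e w' w := by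
      intro w w'
      rw [(hb w).fderiv_eq]
      refine (DFunLike.congr_fun (hbd.hasFDerivAt.clm_apply (hasFDerivAt_const w e)).fderiv
        w').trans ?_
      simp
    have hb0 : ∀ w : E, chartField (1 : G)
        (mulInvariantVectorField (I := 𝓘(ℝ, E)) (G := G) w) e = w := by
      intro w
      refine (hb w).self_of_nhds.trans ?_
      show b e w = w
      rw [← hrel e het]
      exact (hae _).trans (hce w)
    have h2 : fderiv ℝ b e (v : E) (u : E) =
        (fderiv ℝ a e (v : E) (u : E) : E) + fderiv ℝ c e (v : E) (u : E) := by
      have h3 : b =ᶠ[𝓝 e] fun z => (a z).comp (c z) := by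
        filter_upwards [htgt] with z hz using (hrel z hz).symm
      rw [h3.fderiv_eq]
      refine (congrArg (fun L => L (v : E) (u : E))
        (ha.hasFDerivAt.clm_comp hc.hasFDerivAt).fderiv).trans ?_
      exact (congrArg₂ (· + ·) (hae _) (congrArg (fderiv ℝ a e v) (hce u))).trans (add_comm _ _)
    have h4 : fderiv ℝ a e (v : E) (u : E) = fderiv ℝ b e (u : E) (v : E) :=
      (fderiv_fderiv_swap hne u v).symm
    rw [GroupLieAlgebra.bracket_def]
    refine (mlieBracket_eq_lieBracket_chartField (1 : G) _ _).trans ?_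
    show fderiv ℝ _ e _ - fderiv ℝ _ e _ = _
    refine (congrArg₂ (· - ·) (congrArg (fderiv ℝ _ e) (hb0 v))
      (congrArg (fderiv ℝ _ e) (hb0 u))).trans ?_
    refine (congrArg₂ (· - ·) (h1 u v) (h1 v u)).trans ?_
    show fderiv ℝ b e (v : E) (u : E) - fderiv ℝ b e (u : E) (v : E) = _
    rw [h2, h4, add_sub_cancel_left]
  have hAd : ∀ z ∈ φ.target, AdOrbit u (φ.symm z) = c z u := by
    intro z hz
    have h1 := mdifferentiableAt_extChartAt_symm (M := G) het
    have h2 := mdifferentiableAt_conj (E := E) (φ.symm z) (φ.symm e)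
    have h7 : MulAut.conj (φ.symm z) (φ.symm e) = 1 := by rw [he, map_one]
    have h3 : MDifferentiableAt 𝓘(ℝ, E) 𝓘(ℝ, E) φ (MulAut.conj (φ.symm z) (φ.symm e)) := by
      rw [h7]
      exact mdifferentiableAt_extChartAt (mem_chart_source E (1 : G))
    have h4 := mfderiv_comp_apply e h3 (h2.comp e h1) (u : E)
    have h5 := mfderiv_comp_apply e h2 h1 (u : E)
    have h6 : (mfderiv 𝓘(ℝ, E) 𝓘(ℝ, E) (φ ∘ (MulAut.conj (φ.symm z) : G → G) ∘ φ.symm) e u : E) =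
        c z u := by
      rw [mfderiv_eq_fderiv]; rfl
    refine Eq.trans ?_ (h4.symm.trans h6)
    refine Eq.trans ?_ (mfderiv_congr_of_eq φ h7 _).symm
    refine Eq.trans ?_ (mfderiv_extChartAt_self (1 : G) _).symm
    refine Eq.trans ?_ h5.symm
    refine Eq.trans ?_ (mfderiv_congr_of_eq _ he _).symm
    exact congrArg (mfderiv 𝓘(ℝ, E) 𝓘(ℝ, E) (MulAut.conj (φ.symm z) : G → G) 1)
      (dChartSymm_self (E := E) (1 : G) u).symm
  have hcu : ∀ w : E, HasFDerivAt (fun z => c z w) ((fderiv ℝ c e).flip w) e := by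
    intro w
    have h1 := hc.hasFDerivAt.clm_apply (hasFDerivAt_const w e)
    rwa [ContinuousLinearMap.comp_zero, zero_add] at h1
  have hφ1 : HasMFDerivAt 𝓘(ℝ, E) 𝓘(ℝ, E) φ 1 (mfderiv 𝓘(ℝ, E) 𝓘(ℝ, E) φ 1) :=
    (mdifferentiableAt_extChartAt (mem_chart_source E (1 : G))).hasMFDerivAt
  have hcomp := HasMFDerivAt.comp (1 : G) (I' := 𝓘(ℝ, E)) (g := fun z => c z u)
    (hcu u).hasMFDerivAt hφ1
  refine ⟨_, hcomp.congr_of_eventuallyEq ?_, fun v => ?_⟩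
  · filter_upwards [extChartAt_source_mem_nhds (I := 𝓘(ℝ, E)) (1 : G)] with g hg
    exact (congrArg (AdOrbit u) (φ.left_inv hg).symm).trans (hAd _ (φ.map_source hg))
  · refine Eq.trans ?_ (hbr v).symm
    exact congrArg (fun w => fderiv ℝ c e w u) (mfderiv_extChartAt_self (1 : G) v)

end Adjoint

/-! ### Invariance under the adjoint representation of a connected group -/

section Invariance

open Topology Filter VectorField

variable {E : Type*} [NormedAddCommGroup E] [NormedSpace ℝ E]
  {G : Type*} [TopologicalSpace G] [ChartedSpace E G] [Group G] [LieGroup 𝓘(ℝ, E) ∞ G]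

/-- A function on the Lie algebra of a connected group whose derivative vanishes along the adjoint
action of the Lie algebra is invariant under the adjoint action of the group. -/
theorem apply_Ad_eq_of_fderiv_lie_eq_zero [CompleteSpace E] [PreconnectedSpace G] {W : Type*}
    [NormedAddCommGroup W] [NormedSpace ℝ W] {Φ : E → W} (hΦ : Differentiable ℝ Φ)
    (h : ∀ u v : GroupLieAlgebra 𝓘(ℝ, E) G, fderiv ℝ Φ u (⁅v, u⁆ : GroupLieAlgebra 𝓘(ℝ, E) G) = 0)
    (g : G) (u : GroupLieAlgebra 𝓘(ℝ, E) G) : Φ (Ad g u : GroupLieAlgebra 𝓘(ℝ, E) G) = Φ u := by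
  have h1 : ∀ x : GroupLieAlgebra 𝓘(ℝ, E) G,
      HasMFDerivAt 𝓘(ℝ, E) 𝓘(ℝ, W) (fun y : G => Φ (AdOrbit x y)) 1 (0 : E →L[ℝ] W) := by
    intro x
    obtain ⟨L, hL, hLv⟩ := hasMFDerivAt_AdOrbit x
    have h2 := HasMFDerivAt.comp (1 : G) (I' := 𝓘(ℝ, E)) (g := Φ)
      (hΦ (AdOrbit x (1 : G))).hasFDerivAt.hasMFDerivAt hL
    have h3 : (fderiv ℝ Φ (AdOrbit x (1 : G))).comp L = 0 := by
      refine ContinuousLinearMap.ext fun v => ?_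
      have h4 : AdOrbit x (1 : G) = x := Ad_one x
      refine (congrArg (fun z => fderiv ℝ Φ z (L v)) h4).trans ?_
      exact (congrArg (fderiv ℝ Φ x) (hLv v)).trans (h x v)
    exact h2.congr_mfderiv h3
  have h2 : ∀ y : G, HasMFDerivAt 𝓘(ℝ, E) 𝓘(ℝ, W) (fun y : G => Φ (AdOrbit u y)) y
      (0 : E →L[ℝ] W) := by
    intro y
    have hr : MDifferentiableAt 𝓘(ℝ, E) 𝓘(ℝ, E) (fun x : G => x * y⁻¹) y :=
      (contMDiff_mul_right (n := ∞)).mdifferentiableAt (by simp)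
    have h3 : HasMFDerivAt 𝓘(ℝ, E) 𝓘(ℝ, W) (fun x : G => Φ (AdOrbit (Ad y u) x)) (y * y⁻¹)
        (0 : E →L[ℝ] W) := by rw [mul_inv_cancel]; exact h1 _
    have h4 := h3.comp y hr.hasMFDerivAt
    have h5 : (fun x : G => Φ (AdOrbit (Ad y u) x)) ∘ (fun x : G => x * y⁻¹) =
        fun x => Φ (AdOrbit u x) := by
      funext x
      refine congrArg Φ ?_
      show (Ad (x * y⁻¹) (Ad y u) : GroupLieAlgebra 𝓘(ℝ, E) G) = Ad x u
      rw [← Ad_mul, inv_mul_cancel_right]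
    rw [h5] at h4
    exact h4.congr_mfderiv (ContinuousLinearMap.ext fun v => rfl)
  have h3 := eq_of_mfderiv_eq_zero h2 g 1
  exact h3.trans (congrArg Φ (Ad_one u))

variable [FiniteDimensional ℝ E] [PreconnectedSpace G]

theorem polyFun_Ad {f : SymmetricAlgebra ℝ (Module.Dual ℝ (GroupLieAlgebra 𝓘(ℝ, E) G))}
    (hf : f ∈ invPoly (GroupLieAlgebra 𝓘(ℝ, E) G)) (g : G) (u : GroupLieAlgebra 𝓘(ℝ, E) G) :
    polyFun f (Ad g u) = polyFun f u := by
  have : CompleteSpace E := FiniteDimensional.complete ℝ E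
  have hd : ContDiff ℝ ∞ (polyFun f : E → ℝ) := by
    have h := polyFun_contDiff f 0 (LinearMap.id : E →ₗ[ℝ] E)
    simp only [zero_add] at h
    exact h
  have hd' : Differentiable ℝ (polyFun f : E → ℝ) := hd.differentiable (by simp)
  refine apply_Ad_eq_of_fderiv_lie_eq_zero hd' (fun u v => ?_) g u
  exact (hd' u).lineDeriv_eq_fderiv.symm.trans (hf v u)

/-- The substitution `f ↦ f ∘ L` of a linear map into polynomials. -/
def polyComp {V W : Type*} [AddCommGroup V] [Module ℝ V] [AddCommGroup W] [Module ℝ W]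
    (L : V →ₗ[ℝ] W) :
    SymmetricAlgebra ℝ (Module.Dual ℝ W) →ₐ[ℝ] SymmetricAlgebra ℝ (Module.Dual ℝ V) :=
  SymmetricAlgebra.lift (SymmetricAlgebra.ι ℝ (Module.Dual ℝ V) ∘ₗ L.dualMap)

theorem polyFun_polyComp {V W : Type*} [AddCommGroup V] [Module ℝ V] [AddCommGroup W] [Module ℝ W]
    (L : V →ₗ[ℝ] W) (f : SymmetricAlgebra ℝ (Module.Dual ℝ W)) (x : V) :
    polyFun (polyComp L f) x = polyFun f (L x) := by
  have h : (SymmetricAlgebra.lift (Module.Dual.eval ℝ V x)).comp (polyComp L) =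
      SymmetricAlgebra.lift (Module.Dual.eval ℝ W (L x)) := by
    refine symmetricAlgebra_algHom_ext fun ξ => ?_
    simp [polyComp]
  exact DFunLike.congr_fun h f

theorem polyComp_Ad {f : SymmetricAlgebra ℝ (Module.Dual ℝ (GroupLieAlgebra 𝓘(ℝ, E) G))}
    (hf : f ∈ invPoly (GroupLieAlgebra 𝓘(ℝ, E) G)) (g : G) : polyComp (Ad g) f = f :=
  polyFun_injective (funext fun x => (polyFun_polyComp (Ad g) f x).trans (polyFun_Ad hf g x))

theorem form_Ad (B : InvariantInner (GroupLieAlgebra 𝓘(ℝ, E) G)) (g : G)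
    (x y : GroupLieAlgebra 𝓘(ℝ, E) G) : B.form (Ad g x) (Ad g y) = B.form x y := by
  have : CompleteSpace E := FiniteDimensional.complete ℝ E
  let b : E →ₗ[ℝ] E →ₗ[ℝ] ℝ := B.form
  let Φ : E → ℝ := fun z => b z z
  have hΦ : ∀ z v : E, ∃ L : E →L[ℝ] ℝ, HasFDerivAt Φ L z ∧ L v = b z v + b v z := by
    intro z v
    let c : E →L[ℝ] E →L[ℝ] ℝ := LinearMap.toContinuousLinearMap
      ((LinearMap.toContinuousLinearMap : (E →ₗ[ℝ] ℝ) ≃ₗ[ℝ] E →L[ℝ] ℝ).toLinearMap ∘ₗ b)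
    have h1 := c.hasFDerivAt (x := z) |>.clm_apply (hasFDerivAt_id z)
    exact ⟨_, h1, rfl⟩
  have h1 : ∀ z : GroupLieAlgebra 𝓘(ℝ, E) G, B.form (Ad g z) (Ad g z) = B.form z z := by
    refine apply_Ad_eq_of_fderiv_lie_eq_zero (Φ := Φ)
      (fun z => (hΦ z 0).choose_spec.1.differentiableAt) (fun u v => ?_) g
    obtain ⟨L, hL, hLv⟩ := hΦ u (⁅v, u⁆ : GroupLieAlgebra 𝓘(ℝ, E) G)
    rw [hL.fderiv]
    refine hLv.trans ?_
    refine Eq.trans ?_ (B.invariant v u u)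
    exact add_comm _ _
  have h2 := h1 (x + y)
  simp only [map_add, LinearMap.add_apply, h1] at h2
  have h3 := B.symm x y
  have h4 := B.symm (Ad g x) (Ad g y)
  linarith

end Invariance

/-! ### The curvature of the canonical connection -/

section Curvature

theorem mcLin_one {E : Type*} [NormedAddCommGroup E] [NormedSpace ℝ E] {G : Type*}
    [TopologicalSpace G] [ChartedSpace E G] [Group G] [LieGroup 𝓘(ℝ, E) ∞ G] :
    (mcLin (1 : G) : GroupLieAlgebra 𝓘(ℝ, E) G →ₗ[ℝ] _) = LinearMap.id :=
  LinearMap.ext fun v => maurerCartan_one v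

variable {E : Type*} [NormedAddCommGroup E] [NormedSpace ℝ E]
  {F : Type*} [NormedAddCommGroup F] [NormedSpace ℝ F]
  {G : Type*} [TopologicalSpace G] [ChartedSpace E G] [Group G]
  {K : Subgroup G} [ChartedSpace F K]
  (B : InvariantInner (GroupLieAlgebra 𝓘(ℝ, E) G))
  {m : Type*} [Fintype m] (X : Module.Basis m ℝ (GroupLieAlgebra 𝓘(ℝ, F) K))

/-- The orthogonal projection `𝔤 → 𝔨`. -/
def prK : GroupLieAlgebra 𝓘(ℝ, E) G →ₗ[ℝ] GroupLieAlgebra 𝓘(ℝ, F) K :=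
  ∑ i, (B.form (lieInc (X i))).smulRight (X i)

theorem prK_apply (v : GroupLieAlgebra 𝓘(ℝ, E) G) :
    prK B X v = ∑ i, B.form (lieInc (X i)) v • X i := by
  simp [prK, LinearMap.sum_apply]

theorem connection_eq_prK (g : G) (v : TangentSpace 𝓘(ℝ, E) g) :
    connection B X g v = prK B X (maurerCartan g v) := (prK_apply B X _).symm

/-- The orthogonal projection `𝔤 → 𝔭`, as an endomorphism of `𝔤`. -/
def prP : GroupLieAlgebra 𝓘(ℝ, E) G →ₗ[ℝ] GroupLieAlgebra 𝓘(ℝ, E) G :=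
  LinearMap.id - lieInc ∘ₗ prK B X

theorem prP_apply (v : GroupLieAlgebra 𝓘(ℝ, E) G) :
    prP B X v = v - lieInc (prK B X v) := rfl

theorem prK_eq_zero {v : GroupLieAlgebra 𝓘(ℝ, E) G} (hv : v ∈ pSpace F K B) :
    prK B X v = 0 := by
  rw [prK_apply]
  exact Finset.sum_eq_zero fun i _ => by rw [hv (X i), zero_smul]

theorem prP_eq_self {v : GroupLieAlgebra 𝓘(ℝ, E) G} (hv : v ∈ pSpace F K B) :
    prP B X v = v := by
  rw [prP_apply, prK_eq_zero B X hv, map_zero, sub_zero]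

theorem lieInc_prK_add_prP (v : GroupLieAlgebra 𝓘(ℝ, E) G) :
    lieInc (prK B X v) + prP B X v = v := by
  rw [prP_apply, add_sub_cancel]

section Orthonormal

variable {B X} [DecidableEq m] (hX : OrthonormalK B X)
include hX

theorem prK_lieInc (x : GroupLieAlgebra 𝓘(ℝ, F) K) : prK B X (lieInc x) = x := by
  have h : prK B X ∘ₗ lieInc = LinearMap.id := X.ext fun j => by
    simp [prK_apply, hX _ j]
  exact DFunLike.congr_fun h x

theorem prP_lieInc (x : GroupLieAlgebra 𝓘(ℝ, F) K) : prP B X (lieInc x) = 0 := by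
  rw [prP_apply, prK_lieInc hX, sub_self]

theorem prP_mem (v : GroupLieAlgebra 𝓘(ℝ, E) G) : prP B X v ∈ pSpace F K B := by
  intro x
  have h : (B.form.flip (prP B X v)) ∘ₗ lieInc = 0 := X.ext fun j => by
    simp [prP_apply, prK_apply, hX j]
  exact DFunLike.congr_fun h x

theorem prP_prP (v : GroupLieAlgebra 𝓘(ℝ, E) G) : prP B X (prP B X v) = prP B X v :=
  prP_eq_self B X (prP_mem hX v)

end Orthonormal

variable [LieGroup 𝓘(ℝ, E) ∞ G] [LieGroup 𝓘(ℝ, F) ∞ K]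
  [FiniteDimensional ℝ E] [FiniteDimensional ℝ F]

/-- The bilinear map `(a, b) ↦ -pr_𝔨 [pr_𝔭 a, pr_𝔭 b]` on `𝔤`. -/
def curvForm : GroupLieAlgebra 𝓘(ℝ, E) G →ₗ[ℝ] GroupLieAlgebra 𝓘(ℝ, E) G →ₗ[ℝ]
    GroupLieAlgebra 𝓘(ℝ, F) K :=
  LinearMap.mk₂ ℝ (fun a b => -prK B X ⁅prP B X a, prP B X b⁆)
    (fun a b c => by simp [add_comm]) (fun r a b => by simp)
    (fun a b c => by simp [add_comm]) (fun r a b => by simp)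

omit [LieGroup 𝓘(ℝ, F) ∞ K] [FiniteDimensional ℝ F] in
theorem curvForm_apply (a b : GroupLieAlgebra 𝓘(ℝ, E) G) :
    curvForm B X a b = -prK B X ⁅prP B X a, prP B X b⁆ := rfl

variable (hKG : Manifold.IsImmersion 𝓘(ℝ, F) 𝓘(ℝ, E) ∞ (Subtype.val : K → G))
include hKG

theorem lieInc_lie (x y : GroupLieAlgebra 𝓘(ℝ, F) K) :
    (lieInc ⁅x, y⁆ : GroupLieAlgebra 𝓘(ℝ, E) G) =
      ⁅(lieInc x : GroupLieAlgebra 𝓘(ℝ, E) G), (lieInc y : GroupLieAlgebra 𝓘(ℝ, E) G)⁆ := by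
  have : CompleteSpace E := FiniteDimensional.complete ℝ E
  have : CompleteSpace F := FiniteDimensional.complete ℝ F
  exact lieMap_lie K.subtype hKG.contMDiff x y

theorem lieInc_lie_mem_pSpace (x : GroupLieAlgebra 𝓘(ℝ, F) K) {y : GroupLieAlgebra 𝓘(ℝ, E) G}
    (hy : y ∈ pSpace F K B) : ⁅(lieInc x : GroupLieAlgebra 𝓘(ℝ, E) G), y⁆ ∈ pSpace F K B := by
  intro z
  have h := B.invariant (lieInc x) (lieInc z) y
  rw [← lieInc_lie hKG, hy, zero_add] at h
  exact h

variable {B X} [DecidableEq m] (hX : OrthonormalK B X)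
include hX

theorem prK_lieInc_lie (x : GroupLieAlgebra 𝓘(ℝ, F) K) (y : GroupLieAlgebra 𝓘(ℝ, E) G) :
    prK B X ⁅(lieInc x : GroupLieAlgebra 𝓘(ℝ, E) G), y⁆ = ⁅x, prK B X y⁆ := by
  conv_lhs => rw [← lieInc_prK_add_prP B X y]
  rw [lie_add, map_add, ← lieInc_lie hKG, prK_lieInc hX,
    prK_eq_zero B X (lieInc_lie_mem_pSpace B hKG x (prP_mem hX y)), add_zero]

theorem prK_lie (a b : GroupLieAlgebra 𝓘(ℝ, E) G) :
    prK B X ⁅a, b⁆ = ⁅prK B X a, prK B X b⁆ - curvForm B X a b := by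
  have h1 : ⁅a, b⁆ = ⁅(lieInc (prK B X a) : GroupLieAlgebra 𝓘(ℝ, E) G), b⁆ + ⁅prP B X a, b⁆ := by
    rw [← add_lie, lieInc_prK_add_prP]
  have h2 : ⁅prP B X a, b⁆ = -⁅(lieInc (prK B X b) : GroupLieAlgebra 𝓘(ℝ, E) G), prP B X a⁆ +
      ⁅prP B X a, prP B X b⁆ := by
    rw [lie_skew, ← lie_add, lieInc_prK_add_prP]
  rw [h1, h2, map_add, map_add, map_neg, prK_lieInc_lie hKG hX, prK_lieInc_lie hKG hX,
    prK_eq_zero B X (prP_mem hX a), lie_zero, neg_zero, zero_add, curvForm_apply, sub_neg_eq_add]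

/-- The curvature of the canonical connection, by the Maurer-Cartan equation. -/
theorem curvature_eq (g : G) (v w : TangentSpace 𝓘(ℝ, E) g) :
    curvature B X g v w = curvForm B X (mcLin g v) (mcLin g w) := by
  have : CompleteSpace E := FiniteDimensional.complete ℝ E
  let P : E →ₗ[ℝ] F := prK B X
  have h := extDerivOneForm_maurerCartan (LinearMap.toContinuousLinearMap P) g v w
  have hc : (connection B X : Π g : G, TangentSpace 𝓘(ℝ, E) g → GroupLieAlgebra 𝓘(ℝ, F) K) =
      fun g v => prK B X (maurerCartan g v) := by
    funext g v; exact connection_eq_prK B X g v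
  have h2 : extDerivOneForm (connection B X) g v w =
      -prK B X (⁅maurerCartan g v, maurerCartan g w⁆ : GroupLieAlgebra 𝓘(ℝ, E) G) := by
    rw [hc]; exact h
  rw [curvature, h2, prK_lie hKG hX, connection_eq_prK, connection_eq_prK, mcLin_apply, mcLin_apply]
  abel

theorem curvatureCov_eq_pull (g : G) (ξ : Module.Dual ℝ (GroupLieAlgebra 𝓘(ℝ, F) K)) :
    curvatureCov B X g ξ = CForms.pull (mcLin g)
      ((Complex.I / (2 * Real.pi)) ⊗ₜ[ℝ] ofTwoForm fun a b => ξ (curvForm B X a b)) := by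
  have h : (fun v w => ξ (curvature B X g v w)) =
      fun v w => ((curvForm B X).compr₂ ξ) (mcLin g v) (mcLin g w) := by
    funext v w
    rw [curvature_eq hKG hX]; rfl
  rw [CForms.pull_tmul]
  show _ ⊗ₜ[ℝ] ofTwoForm (fun v w => ξ (curvature B X g v w)) = _
  rw [h, ← map_ofTwoForm]
  rfl

theorem curvatureCov_one (ξ : Module.Dual ℝ (GroupLieAlgebra 𝓘(ℝ, F) K)) :
    curvatureCov B X (1 : G) ξ =
      (Complex.I / (2 * Real.pi)) ⊗ₜ[ℝ] ofTwoForm fun a b => ξ (curvForm B X a b) := by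
  rw [curvatureCov_eq_pull hKG hX, mcLin_one, CForms.pull_id_apply]

/-- The form `f(iΘ/2π)` is left invariant. -/
theorem polyCurvature_eq_pull (g : G)
    (f : SymmetricAlgebra ℝ (Module.Dual ℝ (GroupLieAlgebra 𝓘(ℝ, F) K))) :
    polyCurvature B X g f = CForms.pull (mcLin g) (polyCurvature B X 1 f) := by
  have h : polyCurvature B X g =
      ((CForms.pull (mcLin g)).restrictScalars ℝ).comp (polyCurvature B X 1) := by
    refine symmetricAlgebra_algHom_ext fun ξ => ?_
    rw [AlgHom.comp_apply, polyCurvature, polyCurvature, polySubst_ι, polySubst_ι,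
      curvatureCov_one hKG hX, curvatureCov_eq_pull hKG hX]
    rfl
  exact DFunLike.congr_fun h f

/-- If `curvForm (L v, L w) = N (curvForm (v, w))`, then `L` pulls back `f(iΘ/2π)` to
`(f ∘ N)(iΘ/2π)` at the identity. -/
theorem pull_polyCurvature_one {L : GroupLieAlgebra 𝓘(ℝ, E) G →ₗ[ℝ] GroupLieAlgebra 𝓘(ℝ, E) G}
    {N : GroupLieAlgebra 𝓘(ℝ, F) K →ₗ[ℝ] GroupLieAlgebra 𝓘(ℝ, F) K}
    (h : ∀ v w, curvForm B X (L v) (L w) = N (curvForm B X v w))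
    (f : SymmetricAlgebra ℝ (Module.Dual ℝ (GroupLieAlgebra 𝓘(ℝ, F) K))) :
    CForms.pull L (polyCurvature B X (1 : G) f) = polyCurvature B X (1 : G) (polyComp N f) := by
  have h : ((CForms.pull L).restrictScalars ℝ).comp (polyCurvature B X (1 : G)) =
      (polyCurvature B X 1).comp (polyComp N) := by
    refine symmetricAlgebra_algHom_ext fun ξ => ?_
    rw [AlgHom.comp_apply, AlgHom.comp_apply, polyComp, SymmetricAlgebra.lift_ι_apply,
      LinearMap.comp_apply, polyCurvature, polySubst_ι, polySubst_ι,
      curvatureCov_one hKG hX, curvatureCov_one hKG hX]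
    refine (CForms.pull_tmul L _ _).trans ?_
    refine congrArg _ ((map_ofTwoForm L ((curvForm B X).compr₂ ξ)).trans ?_)
    refine congrArg ofTwoForm (funext fun v => funext fun w => ?_)
    exact congrArg ξ (h v w)
  exact DFunLike.congr_fun h f

/-- `f(iΘ/2π)` is horizontal. -/
theorem pull_prP_polyCurvature_one
    (f : SymmetricAlgebra ℝ (Module.Dual ℝ (GroupLieAlgebra 𝓘(ℝ, F) K))) :
    CForms.pull (prP B X) (polyCurvature B X (1 : G) f) = polyCurvature B X (1 : G) f := by
  have h := pull_polyCurvature_one hKG hX (L := prP B X) (N := LinearMap.id)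
    (fun v w => by rw [curvForm_apply, prP_prP hX, prP_prP hX]; rfl) f
  rw [h]
  congr 1
  refine polyFun_injective (funext fun x => polyFun_polyComp _ f x)

end Curvature

/-! ### Horizontality and invariance of the curvature -/

section Horizontal

open Topology Filter

variable {E : Type*} [NormedAddCommGroup E] [NormedSpace ℝ E]
  {F : Type*} [NormedAddCommGroup F] [NormedSpace ℝ F]
  {G : Type*} [TopologicalSpace G] [ChartedSpace E G] [Group G] [LieGroup 𝓘(ℝ, E) ∞ G]
  {K : Subgroup G} [ChartedSpace F K] [LieGroup 𝓘(ℝ, F) ∞ K]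
  {E' : Type*} [NormedAddCommGroup E'] [NormedSpace ℝ E'] [ChartedSpace E' (G ⧸ K)]

/-- A tangent vector of `G` that is vertical for `G → G/K` is the left translate of an element of
the Lie algebra of `K`: it is the velocity of a curve in a coset of `K`. -/
theorem exists_lieInc_eq_maurerCartan [IsManifold 𝓘(ℝ, E') ∞ (G ⧸ K)]
    (hKG : Manifold.IsImmersion 𝓘(ℝ, F) 𝓘(ℝ, E) ∞ (Subtype.val : K → G))
    (hGK : Manifold.IsSubmersion 𝓘(ℝ, E) 𝓘(ℝ, E') ∞ (QuotientGroup.mk : G → G ⧸ K))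
    (g : G) (v : TangentSpace 𝓘(ℝ, E) g)
    (hv : mfderiv 𝓘(ℝ, E) 𝓘(ℝ, E') (QuotientGroup.mk : G → G ⧸ K) g v = 0) :
    ∃ u : GroupLieAlgebra 𝓘(ℝ, F) K, lieInc u = maurerCartan g v := by
  obtain ⟨c, hc0, hc, hcv, hcf⟩ := exists_curve_in_fibre (hGK.isSubmersionAt g) v hv
  have h1 := mdifferentiableAt_mul_left' (E := E) g⁻¹ (c 0)
  obtain ⟨u, hu⟩ := exists_mfderiv_eq_of_curve (hKG.isImmersionAt 1) IsInducing.subtypeVal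
    (c := (fun x => g⁻¹ * x) ∘ c) (by simp [hc0]) (h1.comp 0 hc) (by
      filter_upwards [hcf] with t ht
      exact ⟨⟨g⁻¹ * c t, QuotientGroup.eq.1 ht.symm⟩, rfl⟩)
  refine ⟨u, hu.trans ?_⟩
  refine (mfderiv_comp_apply 0 h1 hc (1 : ℝ)).trans ?_
  refine (mfderiv_congr_of_eq _ hc0 _).trans ?_
  exact congrArg (mfderiv 𝓘(ℝ, E) 𝓘(ℝ, E) (fun x => g⁻¹ * x) g) hcv

theorem lieInc_Ad (hKG : Manifold.IsImmersion 𝓘(ℝ, F) 𝓘(ℝ, E) ∞ (Subtype.val : K → G)) (k : K)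
    (x : GroupLieAlgebra 𝓘(ℝ, F) K) :
    (lieInc (Ad k x) : GroupLieAlgebra 𝓘(ℝ, E) G) = Ad (k : G) (lieInc x) := by
  have hv : ∀ h : K, MDifferentiableAt 𝓘(ℝ, F) 𝓘(ℝ, E) (Subtype.val : K → G) h := fun h =>
    hKG.contMDiff.mdifferentiableAt (by simp)
  have h1 : (Subtype.val : K → G) ∘ (MulAut.conj k : K → K) =
      (MulAut.conj (k : G) : G → G) ∘ (Subtype.val : K → G) := by
    funext x; simp
  have h2 := lieMap_comp (mdifferentiableAt_conj (E := F) k 1) (map_one _) (hv 1) x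
  have h3 := lieMap_comp (hv 1) K.coe_one (mdifferentiableAt_conj (E := E) (k : G) 1) x
  rw [h1] at h2
  exact h2.symm.trans h3

variable [FiniteDimensional ℝ E] [PreconnectedSpace G]
  {B : InvariantInner (GroupLieAlgebra 𝓘(ℝ, E) G)}
  {m : Type*} [Fintype m] [DecidableEq m] {X : Module.Basis m ℝ (GroupLieAlgebra 𝓘(ℝ, F) K)}

theorem Ad_mem_pSpace (hKG : Manifold.IsImmersion 𝓘(ℝ, F) 𝓘(ℝ, E) ∞ (Subtype.val : K → G))
    (k : K) {y : GroupLieAlgebra 𝓘(ℝ, E) G} (hy : y ∈ pSpace F K B) :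
    Ad (k : G) y ∈ pSpace F K B := by
  intro x
  have h : (lieInc x : GroupLieAlgebra 𝓘(ℝ, E) G) = Ad (k : G) (lieInc (Ad k⁻¹ x)) := by
    rw [← lieInc_Ad hKG, ← Ad_mul, mul_inv_cancel, Ad_one]
  rw [h, form_Ad, hy]

variable (hKG : Manifold.IsImmersion 𝓘(ℝ, F) 𝓘(ℝ, E) ∞ (Subtype.val : K → G))
  (hX : OrthonormalK B X)
include hKG hX

theorem prK_Ad (k : K) (a : GroupLieAlgebra 𝓘(ℝ, E) G) :
    prK B X (Ad (k : G) a) = Ad k (prK B X a) := by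
  conv_lhs => rw [← lieInc_prK_add_prP B X a]
  rw [map_add, map_add, ← lieInc_Ad hKG, prK_lieInc hX,
    prK_eq_zero B X (Ad_mem_pSpace hKG k (prP_mem hX a)), add_zero]

theorem prP_Ad (k : K) (a : GroupLieAlgebra 𝓘(ℝ, E) G) :
    prP B X (Ad (k : G) a) = Ad (k : G) (prP B X a) := by
  rw [prP_apply, prP_apply, prK_Ad hKG hX, lieInc_Ad hKG, map_sub]

theorem curvForm_Ad (k : K) (a b : GroupLieAlgebra 𝓘(ℝ, E) G) :
    curvForm B X (Ad (k : G) a) (Ad (k : G) b) = Ad k (curvForm B X a b) := by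
  have : CompleteSpace E := FiniteDimensional.complete ℝ E
  rw [curvForm_apply, curvForm_apply, prP_Ad hKG hX, prP_Ad hKG hX, ← Ad_lie, prK_Ad hKG hX,
    map_neg]

theorem pull_Ad_polyCurvature_one [FiniteDimensional ℝ F] [PreconnectedSpace K]
    {f : SymmetricAlgebra ℝ (Module.Dual ℝ (GroupLieAlgebra 𝓘(ℝ, F) K))}
    (hf : f ∈ invPoly (GroupLieAlgebra 𝓘(ℝ, F) K)) (k : K) :
    CForms.pull (Ad (k : G)) (polyCurvature B X (1 : G) f) = polyCurvature B X (1 : G) f := by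
  rw [pull_polyCurvature_one hKG hX (curvForm_Ad hKG hX k), polyComp_Ad hf]

/-- For an invariant polynomial `f`, the pullback of `f(iΘ/2π)` along a linear map to a tangent
space of `G` depends only on the composition of this map with the projection to `G/K`. -/
theorem pull_comp_mcLin_eq [FiniteDimensional ℝ F] [PreconnectedSpace K]
    [IsManifold 𝓘(ℝ, E') ∞ (G ⧸ K)]
    (hGK : Manifold.IsSubmersion 𝓘(ℝ, E) 𝓘(ℝ, E') ∞ (QuotientGroup.mk : G → G ⧸ K))
    {f : SymmetricAlgebra ℝ (Module.Dual ℝ (GroupLieAlgebra 𝓘(ℝ, F) K))}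
    (hf : f ∈ invPoly (GroupLieAlgebra 𝓘(ℝ, F) K)) {g h : G}
    (hgh : (QuotientGroup.mk g : G ⧸ K) = QuotientGroup.mk h)
    {V : Type*} [AddCommGroup V] [Module ℝ V] (L : V →ₗ[ℝ] TangentSpace 𝓘(ℝ, E) g)
    (M : V →ₗ[ℝ] TangentSpace 𝓘(ℝ, E) h)
    (hLM : ∀ v, (mfderiv 𝓘(ℝ, E) 𝓘(ℝ, E') (QuotientGroup.mk : G → G ⧸ K) g (L v) : E') =
      mfderiv 𝓘(ℝ, E) 𝓘(ℝ, E') (QuotientGroup.mk : G → G ⧸ K) h (M v)) :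
    CForms.pull (mcLin g ∘ₗ L) (polyCurvature B X (1 : G) f) =
      CForms.pull (mcLin h ∘ₗ M) (polyCurvature B X (1 : G) f) := by
  obtain ⟨k, hk⟩ : ∃ k : K, h * k = g := ⟨⟨h⁻¹ * g, QuotientGroup.eq.1 hgh.symm⟩, by simp⟩
  subst hk
  have hr : MDifferentiableAt 𝓘(ℝ, E) 𝓘(ℝ, E) (fun x : G => x * (k : G)) h :=
    (contMDiff_mul_right (n := ∞)).mdifferentiableAt (by simp)
  have hq : ∀ x : G, MDifferentiableAt 𝓘(ℝ, E) 𝓘(ℝ, E') (QuotientGroup.mk : G → G ⧸ K) x :=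
    fun x => hGK.contMDiff.mdifferentiableAt (by simp)
  have hqr : (QuotientGroup.mk : G → G ⧸ K) ∘ (fun x : G => x * (k : G)) = QuotientGroup.mk := by
    funext x
    exact QuotientGroup.eq.2 (by simp)
  have h1 : ∀ v, prP B X (mcLin (h * k) (L v)) = prP B X (Ad (k : G)⁻¹ (mcLin h (M v))) := by
    intro v
    let w : TangentSpace 𝓘(ℝ, E) (h * k) :=
      mfderiv 𝓘(ℝ, E) 𝓘(ℝ, E) (fun x : G => x * (k : G)) h (M v)
    have h2 : (mfderiv 𝓘(ℝ, E) 𝓘(ℝ, E') (QuotientGroup.mk : G → G ⧸ K) (h * k) w : E') =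
        mfderiv 𝓘(ℝ, E) 𝓘(ℝ, E') (QuotientGroup.mk : G → G ⧸ K) h (M v) := by
      have h3 := mfderiv_comp_apply h (hq (h * k)) hr (M v)
      rw [hqr] at h3
      exact h3.symm
    have h3 : mfderiv 𝓘(ℝ, E) 𝓘(ℝ, E') (QuotientGroup.mk : G → G ⧸ K) (h * k) (L v - w) = 0 := by
      rw [map_sub, sub_eq_zero]
      exact (hLM v).trans h2.symm
    obtain ⟨u, hu⟩ := exists_lieInc_eq_maurerCartan hKG hGK (h * k) (L v - w) h3
    have h4 : mcLin (h * k) w = Ad (k : G)⁻¹ (mcLin h (M v)) :=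
      maurerCartan_mul_right h (k : G) (M v)
    rw [← h4, ← sub_eq_zero, ← map_sub, ← map_sub, mcLin_apply, ← hu, prP_lieInc hX]
  have h2 := pull_prP_polyCurvature_one hKG hX f
  have h3 := pull_Ad_polyCurvature_one hKG hX hf k⁻¹
  calc CForms.pull (mcLin (h * k) ∘ₗ L) (polyCurvature B X (1 : G) f)
      = CForms.pull (prP B X ∘ₗ mcLin (h * k) ∘ₗ L) (polyCurvature B X (1 : G) f) := by
        rw [CForms.pull_comp_apply _ (prP B X), h2]
    _ = CForms.pull (prP B X ∘ₗ Ad ((k⁻¹ : K) : G) ∘ₗ mcLin h ∘ₗ M)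
          (polyCurvature B X (1 : G) f) := by
        congr 2
        exact LinearMap.ext h1
    _ = CForms.pull (mcLin h ∘ₗ M) (polyCurvature B X (1 : G) f) := by
        rw [CForms.pull_comp_apply _ (prP B X), h2, CForms.pull_comp_apply _ (Ad _), h3]

end Horizontal

/-! ### Smooth dependence of pullbacks on the linear map -/

section PullSmooth

variable {V W : Type*} [NormedAddCommGroup V] [NormedSpace ℝ V] [NormedAddCommGroup W]
  [NormedSpace ℝ W]

variable (V) in
/-- The pullback of the form `a` on `W` along a linear map `V → W` is a combination of fixed forms
on `V` whose coefficients depend smoothly on the linear map. -/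
def HasSmoothPull (a : CForms W) : Prop :=
  ∃ (κ : Type) (_ : Fintype κ) (c : κ → (V →L[ℝ] W) → ℝ) (b : κ → CForms V),
    (∀ i, ContDiff ℝ ∞ (c i)) ∧ ∀ L : V →L[ℝ] W,
      CForms.pull L.toLinearMap a = ∑ i, c i L • b i

theorem HasSmoothPull.add {a a' : CForms W} (ha : HasSmoothPull V a) (ha' : HasSmoothPull V a') :
    HasSmoothPull V (a + a') := by
  obtain ⟨κ, _, c, b, hc, h⟩ := ha
  obtain ⟨κ', _, c', b', hc', h'⟩ := ha'
  refine ⟨κ ⊕ κ', inferInstance, Sum.elim c c', Sum.elim b b', ?_, fun L => ?_⟩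
  · rintro (i | i)
    · exact hc i
    · exact hc' i
  · rw [map_add, h, h']
    simp

theorem HasSmoothPull.mul {a a' : CForms W} (ha : HasSmoothPull V a) (ha' : HasSmoothPull V a') :
    HasSmoothPull V (a * a') := by
  obtain ⟨κ, _, c, b, hc, h⟩ := ha
  obtain ⟨κ', _, c', b', hc', h'⟩ := ha'
  refine ⟨κ × κ', inferInstance, fun i L => c i.1 L * c' i.2 L, fun i => b i.1 * b' i.2,
    fun i => (hc i.1).mul (hc' i.2), fun L => ?_⟩
  rw [map_mul, h, h', Finset.sum_mul_sum, Fintype.sum_prod_type]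
  simp only [smul_mul_smul_comm]

theorem hasSmoothPull [FiniteDimensional ℝ V] [FiniteDimensional ℝ W] (a : CForms W) :
    HasSmoothPull V a := by
  have hext : ∀ x : ExteriorAlgebra ℝ (Module.Dual ℝ W),
      HasSmoothPull V ((1 : ℂ) ⊗ₜ[ℝ] x : CForms W) := by
    intro x
    induction x using ExteriorAlgebra.induction with
    | algebraMap r =>
      refine ⟨Unit, inferInstance, fun _ _ => 1, fun _ => (1 : ℂ) ⊗ₜ algebraMap ℝ _ r,
        fun _ => contDiff_const, fun L => ?_⟩
      rw [CForms.pull_tmul, AlgHom.commutes]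
      simp
    | ι ξ =>
      let e := Module.finBasis ℝ V
      refine ⟨Fin (Module.finrank ℝ V), inferInstance, fun i L => ξ (L (e i)),
        fun i => (1 : ℂ) ⊗ₜ ExteriorAlgebra.ι ℝ (e.coord i), fun i => ?_, fun L => ?_⟩
      · exact (LinearMap.toContinuousLinearMap ξ).contDiff.comp
          (ContinuousLinearMap.apply ℝ W (e i)).contDiff
      · rw [CForms.pull_tmul, ExteriorAlgebra.map_apply_ι]
        simp only [← TensorProduct.tmul_smul, ← TensorProduct.tmul_sum, ← map_smul, ← map_sum]
        congr 2
        refine e.ext fun j => ?_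
        simp [Finsupp.single_apply]
    | mul x y hx hy =>
      have h := hx.mul hy
      rwa [Algebra.TensorProduct.tmul_mul_tmul, one_mul] at h
    | add x y hx hy =>
      rw [TensorProduct.tmul_add]
      exact hx.add hy
  induction a using TensorProduct.induction_on with
  | zero => exact ⟨Empty, inferInstance, nofun, nofun, nofun, fun L => by simp⟩
  | add a a' ha ha' => exact ha.add ha'
  | tmul z x =>
    have h1 : z ⊗ₜ[ℝ] x = (z ⊗ₜ[ℝ] 1 : CForms W) * (1 : ℂ) ⊗ₜ[ℝ] x := by
      rw [Algebra.TensorProduct.tmul_mul_tmul, one_mul, mul_one]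
    rw [h1]
    refine HasSmoothPull.mul ⟨Unit, inferInstance, fun _ _ => 1, fun _ => z ⊗ₜ[ℝ] 1,
      fun _ => contDiff_const, fun L => ?_⟩ (hext x)
    rw [CForms.pull_tmul, map_one]
    simp

end PullSmooth

/-! ### The Chern-Weil homomorphism -/

section ChernWeil

open Topology Filter

variable {E : Type*} [NormedAddCommGroup E] [NormedSpace ℝ E]
  {F : Type*} [NormedAddCommGroup F] [NormedSpace ℝ F]
  {G : Type*} [TopologicalSpace G] [ChartedSpace E G] [Group G] [LieGroup 𝓘(ℝ, E) ∞ G]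
  {E' : Type*} [NormedAddCommGroup E'] [NormedSpace ℝ E']

theorem mcChart_mfderiv_extChartAt {x h : G} (hh : h ∈ (extChartAt 𝓘(ℝ, E) x).source) (w : E) :
    mcChart x (extChartAt 𝓘(ℝ, E) x h)
      (mfderiv 𝓘(ℝ, E) 𝓘(ℝ, E) (extChartAt 𝓘(ℝ, E) x) h w : E) = (mcLin h w : E) := by
  have h1 : ∀ z ∈ (extChartAt 𝓘(ℝ, E) x).target, ∀ y, (extChartAt 𝓘(ℝ, E) x).symm z = y →
      mcChart x z (mfderiv 𝓘(ℝ, E) 𝓘(ℝ, E) (extChartAt 𝓘(ℝ, E) x) y w : E) = (mcLin y w : E) := by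
    rintro z hz _ rfl
    refine (maurerCartan_dChartSymm hz _).symm.trans ?_
    exact congrArg (maurerCartan _) (dChartSymm_mfderiv hz w)
  exact h1 _ ((extChartAt 𝓘(ℝ, E) x).map_source hh) _ ((extChartAt 𝓘(ℝ, E) x).left_inv hh)

/-- The Maurer-Cartan form along a smooth map from a vector space, in a chart of `G`. -/
theorem mcChart_fderiv {x : G} {τ : E' → G} {z : E'} (hτ : MDifferentiableAt 𝓘(ℝ, E') 𝓘(ℝ, E) τ z)
    (hz : τ z ∈ (extChartAt 𝓘(ℝ, E) x).source) (u : E') :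
    mcChart x (extChartAt 𝓘(ℝ, E) x (τ z)) (fderiv ℝ (extChartAt 𝓘(ℝ, E) x ∘ τ) z u) =
      (mcLin (τ z) (mfderiv 𝓘(ℝ, E') 𝓘(ℝ, E) τ z u) : E) := by
  have h1 : MDifferentiableAt 𝓘(ℝ, E) 𝓘(ℝ, E) (extChartAt 𝓘(ℝ, E) x) (τ z) :=
    mdifferentiableAt_extChartAt (by simpa using hz)
  have h2 := mfderiv_comp_apply z h1 hτ u
  rw [mfderiv_eq_fderiv] at h2
  exact (congrArg (mcChart (E := E) x _) h2).trans (mcChart_mfderiv_extChartAt hz _)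

variable {K : Subgroup G} [ChartedSpace F K] [LieGroup 𝓘(ℝ, F) ∞ K]
  [ChartedSpace E' (G ⧸ K)] [IsManifold 𝓘(ℝ, E') ∞ (G ⧸ K)]
  [FiniteDimensional ℝ E] [FiniteDimensional ℝ F]
  [PreconnectedSpace G] [PreconnectedSpace K]
  {B : InvariantInner (GroupLieAlgebra 𝓘(ℝ, E) G)}
  {m : Type*} [Fintype m] [DecidableEq m] {X : Module.Basis m ℝ (GroupLieAlgebra 𝓘(ℝ, F) K)}
  (hKG : Manifold.IsImmersion 𝓘(ℝ, F) 𝓘(ℝ, E) ∞ (Subtype.val : K → G))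
  (hGK : Manifold.IsSubmersion 𝓘(ℝ, E) 𝓘(ℝ, E') ∞ (QuotientGroup.mk : G → G ⧸ K))
  (hX : OrthonormalK B X)
include hKG hGK hX

/-- Any choice of lifts of the tangent vectors of `G/K` to `G` descends the form `f(iΘ/2π)` to a
smooth form on `G/K`: the form does not depend on the choice, so near each point the lifts may be
taken from a local section. -/
theorem descended_mem_smoothForms [FiniteDimensional ℝ E']
    (R : Π y : G ⧸ K, TangentSpace 𝓘(ℝ, E') y →ₗ[ℝ] TangentSpace 𝓘(ℝ, E) y.out)
    (hR : ∀ (y : G ⧸ K) (v : TangentSpace 𝓘(ℝ, E') y),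
      (mfderiv 𝓘(ℝ, E) 𝓘(ℝ, E') (QuotientGroup.mk : G → G ⧸ K) y.out (R y v) : E') = v)
    {f : SymmetricAlgebra ℝ (Module.Dual ℝ (GroupLieAlgebra 𝓘(ℝ, F) K))}
    (hf : f ∈ invPoly (GroupLieAlgebra 𝓘(ℝ, F) K)) :
    (fun y => CForms.pull (mcLin y.out ∘ₗ R y) (polyCurvature B X (1 : G) f)) ∈
      SmoothForms E' (G ⧸ K) := by
  intro x
  let χ := extChartAt 𝓘(ℝ, E') x
  let σ : Π y : G ⧸ K, CForms (TangentSpace 𝓘(ℝ, E') y) :=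
    fun y => CForms.pull (mcLin y.out ∘ₗ R y) (polyCurvature B X (1 : G) f)
  let b := Module.finBasis ℝ (CForms E')
  refine ⟨Fin (Module.finrank ℝ (CForms E')), inferInstance,
    fun i z => b.repr (localForm σ x z) i, b, fun i z₀ hz₀ => ?_,
    fun z _ => (b.sum_repr (localForm σ x z)).symm⟩
  refine ContDiffAt.contDiffWithinAt ?_
  -- lift along a local section `s` through the chosen representative `g`
  have hy : (QuotientGroup.mk (χ.symm z₀).out : G ⧸ K) = χ.symm z₀ := Quotient.out_eq' _
  let g := (χ.symm z₀).out
  let φ := extChartAt 𝓘(ℝ, E) g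
  obtain ⟨s, hs1, hs2, hs3⟩ := exists_local_section (hGK.isSubmersionAt g)
  rw [hy] at hs1 hs2 hs3
  let τ : E' → G := s ∘ χ.symm
  have hχ : ContMDiffAt 𝓘(ℝ, E') 𝓘(ℝ, E') ∞ χ.symm z₀ := contMDiffAt_extChartAt_symm hz₀
  have hτ : ContMDiffAt 𝓘(ℝ, E') 𝓘(ℝ, E) ∞ τ z₀ := hs2.comp z₀ hχ
  have hτ0 : τ z₀ = g := hs1
  let t : E' → E := φ ∘ τ
  have ht : ContDiffAt ℝ ∞ t z₀ := by
    have h1 : ContMDiffAt 𝓘(ℝ, E) 𝓘(ℝ, E) ∞ φ (τ z₀) := by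
      rw [hτ0]; exact contMDiffAt_extChartAt
    exact (h1.comp z₀ hτ).contDiffAt
  let N : E' → E' →L[ℝ] E := fun z => (mcChart g (t z)).comp (fderiv ℝ t z)
  have hN : ContDiffAt ℝ ∞ N z₀ := by
    have h1 : t z₀ ∈ φ.target := by
      show φ (τ z₀) ∈ φ.target
      rw [hτ0]; exact mem_extChartAt_target g
    exact ((contDiffAt_mcChart h1).comp z₀ ht).clm_comp (ht.fderiv_right (m := ∞) (by simp))
  obtain ⟨κ, _, c, a, hc, hca⟩ := hasSmoothPull (V := E') (W := E) (polyCurvature B X (1 : G) f)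
  -- near `z₀` the lifts given by `s` compute the same form
  have hloc : ∀ᶠ z in 𝓝 z₀, localForm σ x z = ∑ j, c j (N z) • a j := by
    have h1 : ∀ᶠ z in 𝓝 z₀, z ∈ χ.target := (isOpen_extChartAt_target x).mem_nhds hz₀
    have h2 : ∀ᶠ z in 𝓝 z₀, (QuotientGroup.mk (τ z) : G ⧸ K) = χ.symm z :=
      hχ.continuousAt.eventually hs3
    have h3 : ∀ᶠ z in 𝓝 z₀, MDifferentiableAt 𝓘(ℝ, E') 𝓘(ℝ, E) τ z := by
      have h4 : ContMDiffAt 𝓘(ℝ, E') 𝓘(ℝ, E) 1 τ z₀ := hτ.of_le (by norm_cast)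
      filter_upwards [(contMDiffAt_iff_contMDiffAt_nhds (by simp)).1 h4] with z hz
      exact hz.mdifferentiableAt (by simp)
    have h4 : ∀ᶠ z in 𝓝 z₀, τ z ∈ φ.source := by
      refine hτ.continuousAt.preimage_mem_nhds ?_
      rw [hτ0]
      exact extChartAt_source_mem_nhds g
    filter_upwards [h1, h2, h2.eventually_nhds, h3, h4] with z hz hz2 hz2' hz3 hz4
    rw [← hca]
    have h5 : (N z).toLinearMap = mcLin (τ z) ∘ₗ (mfderiv 𝓘(ℝ, E') 𝓘(ℝ, E) τ z).toLinearMap :=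
      LinearMap.ext fun u => mcChart_fderiv hz3 hz4 u
    rw [h5]
    refine (CForms.pull_comp_apply _ _ _).symm.trans ?_
    refine pull_comp_mcLin_eq hKG hX hGK hf ?_ (R (χ.symm z) ∘ₗ (dChartSymm x z).toLinearMap)
      (mfderiv 𝓘(ℝ, E') 𝓘(ℝ, E) τ z).toLinearMap fun v => ?_
    · exact (Quotient.out_eq' _).trans hz2.symm
    · refine (hR _ _).trans ?_
      have h6 : MDifferentiableAt 𝓘(ℝ, E) 𝓘(ℝ, E') (QuotientGroup.mk : G → G ⧸ K) (τ z) :=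
        hGK.contMDiff.mdifferentiableAt (by simp)
      have h7 := mfderiv_comp_apply z h6 hz3 v
      refine Eq.trans ?_ h7
      have h8 : (QuotientGroup.mk : G → G ⧸ K) ∘ τ =ᶠ[𝓝 z] χ.symm := hz2'
      exact (DFunLike.congr_fun h8.mfderiv_eq v).symm
  have h1 : (fun z => b.repr (localForm σ x z) i) =ᶠ[𝓝 z₀]
      fun z => ∑ j, c j (N z) * b.repr (a j) i := by
    filter_upwards [hloc] with z hz
    rw [hz]
    simp
  refine ContDiffAt.congr_of_eventuallyEq ?_ h1
  exact ContDiffAt.sum fun j _ => (((hc j).contDiffAt).comp z₀ hN).mul contDiffAt_const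

theorem exists_isChernWeil [FiniteDimensional ℝ E'] :
    ∃ CW : invPoly (GroupLieAlgebra 𝓘(ℝ, F) K) →ₐ[ℝ] SmoothForms E' (G ⧸ K),
      IsChernWeil (E' := E') B X CW := by
  have h : ∀ y : G ⧸ K, ∃ R : TangentSpace 𝓘(ℝ, E') y →ₗ[ℝ] TangentSpace 𝓘(ℝ, E) y.out,
      ∀ v, (mfderiv 𝓘(ℝ, E) 𝓘(ℝ, E') (QuotientGroup.mk : G → G ⧸ K) y.out (R v) : E') = v := by
    intro y
    have h1 := mfderiv_surjective_of_isSubmersionAt (hGK.isSubmersionAt y.out)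
    let D : E →ₗ[ℝ] E' :=
      (mfderiv 𝓘(ℝ, E) 𝓘(ℝ, E') (QuotientGroup.mk : G → G ⧸ K) y.out).toLinearMap
    obtain ⟨R, hR⟩ := D.exists_rightInverse_of_surjective (LinearMap.range_eq_top.2 h1)
    exact ⟨R, fun v => DFunLike.congr_fun hR v⟩
  choose R hR using h
  let Φ : Π y : G ⧸ K, SymmetricAlgebra ℝ (Module.Dual ℝ (GroupLieAlgebra 𝓘(ℝ, F) K)) →ₐ[ℝ]
      CForms (TangentSpace 𝓘(ℝ, E') y) := fun y =>
    ((CForms.pull (mcLin y.out ∘ₗ R y)).restrictScalars ℝ).comp (polyCurvature B X (1 : G))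
  refine ⟨{ toFun := fun f => ⟨fun y => Φ y f.1, descended_mem_smoothForms hKG hGK hX R hR f.2⟩
            map_one' := Subtype.ext (funext fun y => map_one (Φ y))
            map_mul' := fun f f' => Subtype.ext (funext fun y => map_mul (Φ y) f.1 f'.1)
            map_zero' := Subtype.ext (funext fun y => map_zero (Φ y))
            map_add' := fun f f' => Subtype.ext (funext fun y => map_add (Φ y) f.1 f'.1)
            commutes' := fun r => Subtype.ext (funext fun y => (Φ y).commutes r) }, fun f g => ?_⟩
  refine (CForms.pull_comp_apply _ _ _).symm.trans ?_
  rw [polyCurvature_eq_pull hKG hX]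
  refine pull_comp_mcLin_eq hKG hX hGK f.2 (Quotient.out_eq' _) (_ ∘ₗ _) LinearMap.id fun v => ?_
  exact hR _ _

omit hKG hX [LieGroup 𝓘(ℝ, F) ∞ K] [FiniteDimensional ℝ F] [PreconnectedSpace G]
  [PreconnectedSpace K] [DecidableEq m] in
/-- Pullback along the submersion `G → G/K` is injective on forms. -/
theorem IsChernWeil.unique {CW CW' :
    invPoly (GroupLieAlgebra 𝓘(ℝ, F) K) →ₐ[ℝ] SmoothForms E' (G ⧸ K)}
    (h : IsChernWeil (E' := E') B X CW) (h' : IsChernWeil (E' := E') B X CW') : CW' = CW := by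
  refine AlgHom.ext fun f => Subtype.ext (funext fun y => ?_)
  obtain ⟨g, rfl⟩ := QuotientGroup.mk_surjective y
  exact CForms.pull_injective (mfderiv_surjective_of_isSubmersionAt (hGK.isSubmersionAt g))
    ((h' f g).trans (h f g).symm)

omit hKG hGK hX [LieGroup 𝓘(ℝ, E) ∞ G] [LieGroup 𝓘(ℝ, F) ∞ K] [IsManifold 𝓘(ℝ, E') ∞ (G ⧸ K)]
  [FiniteDimensional ℝ F] [PreconnectedSpace G] [PreconnectedSpace K] [DecidableEq m] in
theorem IsChernWeil.resIdentity_eq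
    {CW : invPoly (GroupLieAlgebra 𝓘(ℝ, F) K) →ₐ[ℝ] SmoothForms E' (G ⧸ K)}
    (h : IsChernWeil (E' := E') B X CW) (f : invPoly (GroupLieAlgebra 𝓘(ℝ, F) K)) :
    resIdentity (F := F) (E' := E') B (CW f) =
      CForms.pull (pSpace F K B).subtype (polyCurvature B X (1 : G) f.1) := by
  rw [← h f 1]
  exact CForms.pull_comp_apply _ _ _

end ChernWeil

/-! ### The map `𝒜` on polynomials -/

section MapA

variable {E : Type*} [NormedAddCommGroup E] [NormedSpace ℝ E]
  {F : Type*} [NormedAddCommGroup F] [NormedSpace ℝ F]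
  {G : Type*} [TopologicalSpace G] [ChartedSpace E G] [Group G]
  {K : Subgroup G} [ChartedSpace F K]
  (B : InvariantInner (GroupLieAlgebra 𝓘(ℝ, E) G))
  {m : Type*} [Fintype m] (X : Module.Basis m ℝ (GroupLieAlgebra 𝓘(ℝ, F) K))
  {n : Type*} [Fintype n] (Y : Module.Basis n ℝ (pSpace F K B))

theorem lam_commute (x y : GroupLieAlgebra 𝓘(ℝ, F) K) : Commute (lam B Y x) (lam B Y y) := by
  unfold lam
  refine ((Commute.sum_left _ _ _ fun a _ => Commute.sum_left _ _ _ fun b _ =>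
    Commute.sum_right _ _ _ fun c _ =>
      Commute.sum_right _ _ _ fun d _ => ?_).smul_left _).smul_right _
  exact (((ι_mul_ι_commute_ι _ _ _).mul_right (ι_mul_ι_commute_ι _ _ _)).smul_left _).smul_right _

theorem lamBar_commute (x y : GroupLieAlgebra 𝓘(ℝ, F) K) :
    Commute (lamBar B Y x) (lamBar B Y y) := by
  show _ ⊗ₜ[ℝ] _ * _ ⊗ₜ[ℝ] _ = _ ⊗ₜ[ℝ] _ * _ ⊗ₜ[ℝ] _
  rw [Algebra.TensorProduct.tmul_mul_tmul, Algebra.TensorProduct.tmul_mul_tmul,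
    (lam_commute B Y x y).eq]

/-- The linear map on `𝔨*` that sends the coordinates dual to `X_j` to `iλ(X_j)/2π`. -/
def lamCov : Module.Dual ℝ (GroupLieAlgebra 𝓘(ℝ, F) K) →ₗ[ℝ]
    ℂ ⊗[ℝ] ExteriorAlgebra ℝ (pSpace F K B) :=
  ∑ j, (Module.Dual.eval ℝ _ (X j)).smulRight (lamBar B Y (X j))

theorem lamCov_apply (ξ : Module.Dual ℝ (GroupLieAlgebra 𝓘(ℝ, F) K)) :
    lamCov B X Y ξ = ∑ j, ξ (X j) • lamBar B Y (X j) := by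
  simp [lamCov, LinearMap.sum_apply]

/-- Substitution of `iλ/2π` in polynomials on `𝔨`. -/
def lamSubst : SymmetricAlgebra ℝ (Module.Dual ℝ (GroupLieAlgebra 𝓘(ℝ, F) K)) →ₐ[ℝ]
    ℂ ⊗[ℝ] ExteriorAlgebra ℝ (pSpace F K B) :=
  polySubst (lamCov B X Y) fun ξ η => by
    rw [lamCov_apply, lamCov_apply]
    exact Commute.sum_left _ _ _ fun i _ => Commute.sum_right _ _ _ fun j _ =>
      ((lamBar_commute B Y _ _).smul_left _).smul_right _

theorem iterPartial_polyInc [DecidableEq m]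
    (f : SymmetricAlgebra ℝ (Module.Dual ℝ (GroupLieAlgebra 𝓘(ℝ, F) K))) (l : List m) :
    iterPartial X l (polyInc f).1 = fun x => ((MvPolynomial.eval (X.repr x)
      (l.foldr (fun i q => MvPolynomial.pderiv i q) (coordPoly X f)) : ℝ) : ℂ) := by
  induction l with
  | nil =>
    funext x
    exact congrArg Complex.ofReal (eval_coordPoly X f x).symm
  | cons j l ih =>
    funext x
    rw [iterPartial, ih]
    exact (hasLineDerivAt_eval X _ x j).lineDeriv

theorem taylorSubst_polyInc_term [DecidableEq m]
    (f : SymmetricAlgebra ℝ (Module.Dual ℝ (GroupLieAlgebra 𝓘(ℝ, F) K))) (r : ℕ) :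
    (1 / (r.factorial : ℂ)) • ∑ j : Fin r → m, iterPartial X (List.ofFn j) (polyInc f).1 0 •
        (List.ofFn fun l => lamBar B Y (X (j l))).prod =
      (r.factorial : ℝ)⁻¹ • taylorTerm (fun i => lamBar B Y (X i)) r (coordPoly X f) := by
  have h : ∀ (c : ℝ) (x : ℂ ⊗[ℝ] ExteriorAlgebra ℝ (pSpace F K B)), (c : ℂ) • x = c • x :=
    fun c x => algebraMap_smul ℂ c x
  have h1 : (1 / (r.factorial : ℂ)) = (((r.factorial : ℝ)⁻¹ : ℝ) : ℂ) := by simp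
  rw [h1, h, taylorTerm]
  refine congrArg _ (Finset.sum_congr rfl fun j _ => ?_)
  rw [iterPartial_polyInc, h, map_zero, Finsupp.coe_zero]

/-- The Taylor expansion at the origin of a polynomial computes the substitution. -/
theorem taylorSubst_polyInc [DecidableEq m]
    (f : SymmetricAlgebra ℝ (Module.Dual ℝ (GroupLieAlgebra 𝓘(ℝ, F) K))) :
    taylorSubst B X Y (polyInc f) = lamSubst B X Y f := by
  have hΨ : ∀ i, (lamSubst B X Y).comp (coordPoly X).symm.toAlgHom (MvPolynomial.X i) =
      lamBar B Y (X i) := by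
    intro i
    show lamSubst B X Y ((coordPoly X).symm (MvPolynomial.X i)) = _
    rw [coordPoly_symm_X, lamSubst, polySubst_ι, lamCov_apply]
    simp [Finsupp.single_apply]
  have h := finsum_taylorTerm ((lamSubst B X Y).comp (coordPoly X).symm.toAlgHom) (coordPoly X f)
  simp only [hΨ] at h
  rw [taylorSubst, finsum_congr (taylorSubst_polyInc_term B X Y f), h]
  exact congrArg (lamSubst B X Y) ((coordPoly X).symm_apply_apply f)

variable {B Y} in
omit [Fintype n] in
theorem flat_eq_coord [DecidableEq n] (hY : OrthonormalP B Y) (a : n) :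
    flat B (Y a) = Y.coord a := by
  refine Y.ext fun b => ?_
  refine (hY a b).trans ?_
  simp [Finsupp.single_apply, eq_comm]

variable [LieGroup 𝓘(ℝ, E) ∞ G] [LieGroup 𝓘(ℝ, F) ∞ K]
  [FiniteDimensional ℝ E] [FiniteDimensional ℝ F] {B X Y}

/-- On covectors, substitution of `iλ/2π` is the restriction to `𝔭` of the curvature. -/
theorem map_flat_lamCov [DecidableEq m] [DecidableEq n]
    (hKG : Manifold.IsImmersion 𝓘(ℝ, F) 𝓘(ℝ, E) ∞ (Subtype.val : K → G))
    (hX : OrthonormalK B X) (hY : OrthonormalP B Y)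
    (ξ : Module.Dual ℝ (GroupLieAlgebra 𝓘(ℝ, F) K)) :
    Algebra.TensorProduct.map (AlgHom.id ℂ ℂ) (ExteriorAlgebra.map (flat B)) (lamCov B X Y ξ) =
      CForms.pull (pSpace F K B).subtype (curvatureCov B X (1 : G) ξ) := by
  have h1 : lamCov B X Y ξ =
      (Complex.I / (2 * Real.pi)) ⊗ₜ[ℝ] ∑ j, ξ (X j) • lam B Y (X j) := by
    rw [lamCov_apply, TensorProduct.tmul_sum]
    exact Finset.sum_congr rfl fun j _ => (TensorProduct.tmul_smul _ _ _).symm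
  have h2 : ∀ a b, ξ (curvForm B X (Y a) (Y b)) = -∑ j, ξ (X j) *
      B.form (lieInc (X j))
        ⁅(Y a : GroupLieAlgebra 𝓘(ℝ, E) G), (Y b : GroupLieAlgebra 𝓘(ℝ, E) G)⁆ := by
    intro a b
    rw [curvForm_apply, prP_eq_self B X (Y a).2, prP_eq_self B X (Y b).2, prK_apply, map_neg,
      map_sum]
    simp only [map_smul, smul_eq_mul, mul_comm]
  have h3 := map_ofTwoForm (pSpace F K B).subtype ((curvForm B X).compr₂ ξ)
  have h4 := ofTwoForm_eq_sum Y (((curvForm B X).compr₂ ξ).compl₁₂ (pSpace F K B).subtype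
    (pSpace F K B).subtype)
  rw [curvatureCov_one hKG hX, h1, CForms.pull_tmul]
  refine (Algebra.TensorProduct.map_tmul _ _ _ _).trans ?_
  refine congrArg _ (Eq.trans ?_ (h4.symm.trans h3.symm))
  simp only [LinearMap.compl₁₂_apply, LinearMap.compr₂_apply, Submodule.subtype_apply, h2, map_sum,
    map_smul, lam, map_mul, ExteriorAlgebra.map_apply_ι, flat_eq_coord hY]
  simp only [Finset.smul_sum, smul_smul, neg_smul, Finset.sum_smul, smul_neg]
  rw [Finset.sum_comm]
  refine Finset.sum_congr rfl fun a _ => ?_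
  rw [Finset.sum_comm]
  refine Finset.sum_congr rfl fun b _ => ?_
  rw [← Finset.sum_neg_distrib]
  refine Finset.sum_congr rfl fun j _ => ?_
  rw [← neg_smul]
  congr 1
  ring

theorem mapA_polyInc [DecidableEq m] [DecidableEq n]
    (hKG : Manifold.IsImmersion 𝓘(ℝ, F) 𝓘(ℝ, E) ∞ (Subtype.val : K → G))
    (hX : OrthonormalK B X) (hY : OrthonormalP B Y)
    (f : SymmetricAlgebra ℝ (Module.Dual ℝ (GroupLieAlgebra 𝓘(ℝ, F) K))) :
    mapA B X Y (polyInc f) = CForms.pull (pSpace F K B).subtype (polyCurvature B X (1 : G) f) := by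
  have h : ((Algebra.TensorProduct.map (AlgHom.id ℂ ℂ) (ExteriorAlgebra.map (flat B)) :
      ℂ ⊗[ℝ] ExteriorAlgebra ℝ (pSpace F K B) →ₐ[ℂ] CForms (pSpace F K B)).restrictScalars ℝ).comp
        (lamSubst B X Y) =
      ((CForms.pull (pSpace F K B).subtype).restrictScalars ℝ).comp
        (polyCurvature B X (1 : G)) := by
    refine symmetricAlgebra_algHom_ext fun ξ => ?_
    rw [AlgHom.comp_apply, AlgHom.comp_apply, lamSubst, polyCurvature, polySubst_ι, polySubst_ι]
    exact map_flat_lamCov hKG hX hY ξ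
  rw [mapA, taylorSubst_polyInc]
  exact DFunLike.congr_fun h f

end MapA

end HomChernWeil

end

open HomChernWeil
theorem mainTheorem9
    {E : Type*} [NormedAddCommGroup E] [NormedSpace ℝ E] [FiniteDimensional ℝ E]
    {F : Type*} [NormedAddCommGroup F] [NormedSpace ℝ F] [FiniteDimensional ℝ F]
    {E' : Type*} [NormedAddCommGroup E'] [NormedSpace ℝ E'] [FiniteDimensional ℝ E']
    {G : Type*} [TopologicalSpace G] [ChartedSpace E G] [Group G] [LieGroup 𝓘(ℝ, E) ∞ G]
    [ConnectedSpace G]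
    (K : Subgroup G) (hK : IsClosed (K : Set G)) [ConnectedSpace K]
    [ChartedSpace F K] [LieGroup 𝓘(ℝ, F) ∞ K]
    (hKG : Manifold.IsImmersion 𝓘(ℝ, F) 𝓘(ℝ, E) ∞ (Subtype.val : K → G))
    [ChartedSpace E' (G ⧸ K)] [IsManifold 𝓘(ℝ, E') ∞ (G ⧸ K)]
    (hGK : Manifold.IsSubmersion 𝓘(ℝ, E) 𝓘(ℝ, E') ∞ (QuotientGroup.mk : G → G ⧸ K))
    (B : InvariantInner (GroupLieAlgebra 𝓘(ℝ, E) G))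
    {m : Type*} [Fintype m] [DecidableEq m]
    (X : Module.Basis m ℝ (GroupLieAlgebra 𝓘(ℝ, F) K)) (hX : OrthonormalK B X)
    {n : Type*} [Fintype n] [DecidableEq n]
    (Y : Module.Basis n ℝ (pSpace F K B)) (hY : OrthonormalP B Y) :
    ∃ CW : invPoly (GroupLieAlgebra 𝓘(ℝ, F) K) →ₐ[ℝ] SmoothForms E' (G ⧸ K),
      (IsChernWeil (E' := E') B X CW ∧
        ∀ CW' : invPoly (GroupLieAlgebra 𝓘(ℝ, F) K) →ₐ[ℝ] SmoothForms E' (G ⧸ K),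
          IsChernWeil (E' := E') B X CW' → CW' = CW) ∧
      ∀ f : invPoly (GroupLieAlgebra 𝓘(ℝ, F) K),
        resIdentity (F := F) (E' := E') B (CW f) = mapA B X Y (polyInc f.1) := by
  obtain ⟨CW, hCW⟩ := exists_isChernWeil hKG hGK hX
  exact ⟨CW, ⟨hCW, fun CW' h => hCW.unique hGK h⟩, fun f =>
    (hCW.resIdentity_eq f).trans (mapA_polyInc hKG hX hY f.1).symm⟩
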